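/- **Setting.** Let $\mathcal X=\prod_{v\in V}\mathcal X_v$ be a finite product of finite sets, $\varphi:\mathcal X\to\mathbb R^p$, and for $\theta\in\mathbb R^p$ let $$p(x\mid\theta)=\frac{e^{\theta^\top\varphi(x)}}{C(\theta)},\qquad C(\theta)=\sum_{x\in\mathcal X}e^{\theta^\top\varphi(x)} .$$ Fix $\theta^*\in\mathbb R^p$, put $T=\{j:\theta^*_j\neq0\}$, $s=|T|=\|\theta^*\|_0\ge1$, and let $H^*$ be the covariance matrix of $\varphi(X)$ for $X\sim p(\cdot\mid\theta^*)$. Let $X_1,\dots,X_n$ ($n\ge1$) be i.i.d. with law $p(\cdot\mid\theta^*)$. On the same probability space let $Y_1,\dots,Y_m$ ($m\ge1$) be a stationary Markov chain on $\mathcal X$ with transition matrix $P$ and stationary initial law $h$, where $h(y)>0$ for all $y\in\mathcal X$. (No joint assumption is made on the sample $(X_i)$ and the chain $(Y_i)$.) Let $\kappa$ be the norm of the operator $(Pf)(y)=\sum_xP(y,x)f(x)$ on $\{f\in L^2(h):\sum_yh(y)f(y)=0\}$, and assume that the absolute spectral gap $1-\kappa$ is positive. If $P$ is reversible, $\kappa$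 is the largest modulus of an eigenvalue of $P$ on this space. Put $$\beta_1=\frac{1+\kappa}{1-\kappa},\qquad \beta_2=\begin{cases}\frac13,&\kappa=0,\\ \frac5{1-\kappa},&\kappa\in(0,1),\end{cases}\qquad M_1=\sum_{y\in\mathcal X}h(y)\Big(\frac{p(y\mid\theta^*)}{h(y)}\Big)^2,\qquad M_2=\max_{y\in\mathcal X}\frac{p(y\mid\theta^*)}{h(y)} .$$ For $\lambda_1,\lambda_2>0$ let $\widehat\theta$ be the elastic-net penalized MCMC-MLE, i.e. a minimizer over $\theta\in\mathbb R^p$ of $$-\frac1n\sum_{i=1}^n\theta^\top\varphi(X_i)+\log\Big(\frac1m\sum_{i=1}^m\frac{e^{\theta^\top\varphi(Y_i)}}{h(Y_i)}\Big)+\lambda_1\|\theta\|_1+\lambda_2\|\theta\|_2^2 .$$ For $\zeta>1$ define the compatibility factor $$F(\zeta,T,H^*)=\inf\Big\{\frac{s\,\theta^\top H^*\theta}{\|\theta_T\|_1^2}:\ 0\ne\theta\in\mathbb R^p,\ \|\theta_{T^c}\|_1\le\zeta\|\theta_T\|_1\Big\}.$$ **Theorem.** Let $K,B,C_{\min}>0$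 and $\zeta>1$ be such that $\|\varphi(y)\|_\infty\le K$ for all $y\in\mathcal X$, $\|\theta^*\|_\infty\le B$, and $F(\zeta,T,H^*)\ge C_{\min}$ (in particular, this holds if the compatibility factor is at least $C_{\min}$ uniformly over all index sets $T\subseteq\{1,\dots,p\}$ and all $\zeta>1$). Let $$\tau_1=\frac{\zeta-1}{\zeta+1}\lambda_1-2\lambda_2B,\qquad \tau_2=\frac{C_{\min}}{2s(\zeta+1)^2},$$ and assume $\tau_1>0$ and $\frac{(\zeta+1)s\lambda_1}{C_{\min}}\le\frac1{4Ke}$. Then $$\|\widehat\theta-\theta^*\|_1\le e\,C_{\min}^{-1}(\zeta+1)s\lambda_1$$ with probability at least $1-\delta_1-\delta_2$, where $$\delta_1=2p\,e^{-\frac{n\tau_1^2}{8K^2}}+2p\,e^{-\frac{m\tau_1^2}{16K(8K\beta_1M_1+\tau_1\beta_2M_2)}}+e^{-\frac m{4(2\beta_1M_1+\beta_2M_2)}},$$ $$\delta_2=2e^{-\frac m{4(2\beta_1M_1+\beta_2M_2)}}+2p^2e^{-\frac{m\tau_2^2}{16K^2(8K^2\beta_1M_1+\tau_2\beta_2M_2)}}+2p\,e^{-\frac{m\tau_2^2}{64K^3(8K\beta_1M_1+\tau_2\beta_2M_2)}}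 .$$ -/

import Mathlib

open MeasureTheory ProbabilityTheory

namespace MCMCMLE

noncomputable section

/-! ### The exponential family on a finite state space -/

/-- The Euclidean pairing `θᵀ v` in `ℝ^p`. -/
def dot {p : ℕ} (θ v : Fin p → ℝ) : ℝ := ∑ j, θ j * v j

/-- The `ℓ₁`-norm on `ℝ^p`. -/
def l1 {p : ℕ} (θ : Fin p → ℝ) : ℝ := ∑ j, |θ j|

/-- The `ℓ₁`-norm of the restriction of `θ` to the index set `T`. -/
def l1On {p : ℕ} (T : Finset (Fin p)) (θ : Fin p → ℝ) : ℝ := ∑ j ∈ T, |θ j|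

/-- The support `{j : θ_j ≠ 0}`; its cardinality is `‖θ‖₀`. -/
def supp {p : ℕ} (θ : Fin p → ℝ) : Finset (Fin p) := {j | θ j ≠ 0}

section Model

variable {E : Type*} [Fintype E] {p : ℕ}

/-- The normalizing constant `C(θ) = ∑_x exp(θᵀ φ(x))`. -/
def normConst (φ : E → Fin p → ℝ) (θ : Fin p → ℝ) : ℝ :=
  ∑ x, Real.exp (dot θ (φ x))

/-- The probability mass function `p(x | θ) = exp(θᵀ φ(x)) / C(θ)`. -/
def pmf (φ : E → Fin p → ℝ) (θ : Fin p → ℝ) (x : E) : ℝ :=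
  Real.exp (dot θ (φ x)) / normConst φ θ

/-- The mean `E_θ φ_j(X)`. -/
def meanStat (φ : E → Fin p → ℝ) (θ : Fin p → ℝ) (j : Fin p) : ℝ :=
  ∑ x, pmf φ θ x * φ x j

/-- The covariance matrix of `φ(X)` for `X ∼ p(· | θ)`. -/
def covStat (φ : E → Fin p → ℝ) (θ : Fin p → ℝ) : Matrix (Fin p) (Fin p) ℝ :=
  fun j k => ∑ x, pmf φ θ x * ((φ x j - meanStat φ θ j) * (φ x k - meanStat φ θ k))

/-! ### The Monte Carlo likelihood and the elastic-net criterion -/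

/-- The MCMC negative log-likelihood
`-(1/n) ∑ θᵀ φ(x_i) + log ((1/m) ∑ exp(θᵀ φ(y_i)) / h(y_i))`. -/
def mcLoss {n m : ℕ} (φ : E → Fin p → ℝ) (h : E → ℝ) (x : Fin n → E) (y : Fin m → E)
    (θ : Fin p → ℝ) : ℝ :=
  -((1 / (n : ℝ)) * ∑ i, dot θ (φ (x i))) +
    Real.log ((1 / (m : ℝ)) * ∑ i, Real.exp (dot θ (φ (y i))) / h (y i))

/-- The elastic-net penalized MCMC negative log-likelihood. -/
def enetCriterion {n m : ℕ} (φ : E → Fin p → ℝ) (h : E → ℝ) (lam₁ lam₂ : ℝ)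
    (x : Fin n → E) (y : Fin m → E) (θ : Fin p → ℝ) : ℝ :=
  mcLoss φ h x y θ + lam₁ * l1 θ + lam₂ * ∑ j, θ j ^ 2

/-! ### Sampling schemes -/

/-- `X_1, …, X_n` are independent with common mass function `f`. -/
structure IsIIDSample {Ω : Type*} [MeasurableSpace Ω] [MeasurableSpace E] {n : ℕ}
    (μ : Measure Ω) (f : E → ℝ) (X : Fin n → Ω → E) : Prop where
  measurable : ∀ i, Measurable (X i)
  indep : iIndepFun X μ
  law : ∀ i x, μ.real {ω | X i ω = x} = f x

/-- `Q` is a transition matrix. -/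
structure IsTransition (Q : Matrix E E ℝ) : Prop where
  nonneg : ∀ y x, 0 ≤ Q y x
  sum_eq_one : ∀ y, ∑ x, Q y x = 1

/-- `h` is a strictly positive probability vector that is stationary for `Q`. -/
structure IsStationaryLaw (Q : Matrix E E ℝ) (h : E → ℝ) : Prop where
  pos : ∀ y, 0 < h y
  sum_eq_one : ∑ y, h y = 1
  stationary : ∀ x, ∑ y, h y * Q y x = h x

/-- `Y_1, …, Y_m` is a Markov chain with transition matrix `Q` started from `h`. -/
structure IsMarkovChain {Ω : Type*} [MeasurableSpace Ω] [MeasurableSpace E] {m : ℕ}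
    (μ : Measure Ω) (Q : Matrix E E ℝ) (h : E → ℝ) (Y : Fin m → Ω → E) : Prop where
  measurable : ∀ i, Measurable (Y i)
  init : ∀ (hm : 0 < m) (y : E), μ.real {ω | Y ⟨0, hm⟩ ω = y} = h y
  step : ∀ (k : ℕ) (hk : k + 1 < m) (y : Fin m → E),
    μ.real {ω | ∀ i : Fin m, i.val ≤ k + 1 → Y i ω = y i} =
      μ.real {ω | ∀ i : Fin m, i.val ≤ k → Y i ω = y i} *
        Q (y ⟨k, Nat.lt_of_succ_lt hk⟩) (y ⟨k + 1, hk⟩)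

/-- `κ`, where `1 - κ` is the absolute spectral gap of `Q`: the norm of the operator
`(Q f)(y) = ∑_x Q(y, x) f(x)` on the functions in `L²(h)` of `h`-mean zero. -/
def kappa (h : E → ℝ) (Q : Matrix E E ℝ) : ℝ :=
  sSup {r | ∃ f : E → ℝ, ∑ y, h y * f y = 0 ∧ ∑ y, h y * f y ^ 2 ≤ 1 ∧
    r = √(∑ y, h y * (Q.mulVec f y) ^ 2)}

/-- `M₁ = E_{Y∼h} (p(Y | θ) / h(Y))²`. -/
def bigM₁ (φ : E → Fin p → ℝ) (θ : Fin p → ℝ) (h : E → ℝ) : ℝ :=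
  ∑ y, h y * (pmf φ θ y / h y) ^ 2

/-- `M₂ = max_y p(y | θ) / h(y)`. -/
def bigM₂ (φ : E → Fin p → ℝ) (θ : Fin p → ℝ) (h : E → ℝ) : ℝ :=
  ⨆ y, pmf φ θ y / h y

end Model

/-- `β₁ = (1 + κ) / (1 - κ)`. -/
def beta₁ (κ : ℝ) : ℝ := (1 + κ) / (1 - κ)

open Classical in
/-- `β₂ = 1/3` if `κ = 0`, and `β₂ = 5 / (1 - κ)` if `0 < κ < 1`. -/
def beta₂ (κ : ℝ) : ℝ := if κ = 0 then 1 / 3 else 5 / (1 - κ)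

/-! ### The compatibility factor -/

/-- The cone `{θ : ‖θ_{Tᶜ}‖₁ ≤ ζ ‖θ_T‖₁}`. -/
def cone {p : ℕ} (ζ : ℝ) (T : Finset (Fin p)) : Set (Fin p → ℝ) :=
  {θ | l1On Tᶜ θ ≤ ζ * l1On T θ}

/-- The compatibility factor
`inf {s (θᵀ Σ θ) / ‖θ_T‖₁² : 0 ≠ θ ∈ cone ζ T}`, with value `⊤` for an empty infimum. -/
def compatFactor {p : ℕ} (s : ℕ) (ζ : ℝ) (T : Finset (Fin p))
    (Sig : Matrix (Fin p) (Fin p) ℝ) : EReal :=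
  ⨅ θ : {θ : Fin p → ℝ // θ ≠ 0 ∧ θ ∈ cone ζ T},
    (((s : ℝ) * dot θ.1 (Sig.mulVec θ.1) / l1On T θ.1 ^ 2 : ℝ) : EReal)

/-! ### The tail terms -/

/-- The tail term `δ₁`. -/
def delta₁ (n m p : ℕ) (K β₁ β₂ M₁ M₂ τ : ℝ) : ℝ :=
  2 * p * Real.exp (-(n * τ ^ 2 / (8 * K ^ 2))) +
  2 * p * Real.exp (-(m * τ ^ 2 / (16 * K * (8 * K * β₁ * M₁ + τ * β₂ * M₂)))) +
  Real.exp (-(m / (4 * (2 * β₁ * M₁ + β₂ * M₂))))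

/-- The tail term `δ₂`. -/
def delta₂ (m p : ℕ) (K β₁ β₂ M₁ M₂ τ : ℝ) : ℝ :=
  2 * Real.exp (-(m / (4 * (2 * β₁ * M₁ + β₂ * M₂)))) +
  2 * p ^ 2 * Real.exp
    (-(m * τ ^ 2 / (16 * K ^ 2 * (8 * K ^ 2 * β₁ * M₁ + τ * β₂ * M₂)))) +
  2 * p * Real.exp
    (-(m * τ ^ 2 / (64 * K ^ 3 * (8 * K * β₁ * M₁ + τ * β₂ * M₂))))

end

end MCMCMLE

/-! A deterministic oracle inequality is combined with exponential inequalities for the two samples.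
Deterministic part (`l1_error_le`). With importance weights `g = p(· | θ*) / h`, the Monte Carlo
likelihood is a log-sum-exp, so its directional derivative along `Δ = θhat - θ*` is the difference
between a tilted mean along the chain and the mean over the sample. If this gradient is at most `τ₁`
at `θ*`, convexity and the penalty force `Δ` into the cone, and `τ₁` is chosen so that the ridge
bias is absorbed. If also the weighted variance is at least `7/16 · C/s · ‖b_T‖₁²` on the cone,
following the segment from `θ*` only to `ℓ₁`-distance `e · R`, where `R = (ζ+1) s λ₁ / C`,
contradicts the optimality of `θhat` when `‖Δ‖₁ > e · R`. The smallness condition keeps the tilt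
factor above `e^{-1/2}` there. Probabilistic part. Hoeffding's inequality handles the i.i.d. sample.
The chain is handled by a Bernstein inequality (`chain_bernstein`) that needs no reversibility: the
moment generating function is a product of multiplied transition operators, and each is dominated in
norm by the multiplied operator `(1-κ)Π + κI`, with `Π` the projection on constants. The norm of
this rank-one perturbation is controlled by a resolvent condition (`resolvent_sum_le`). The
inequality is applied to the total mass of the weights, to the weighted centred statistics (gradient
and mean shift) and to their products (covariance). A union bound gives `δ₁ + δ₂`. -/

namespace MCMCMLE

/-! ### Scalar inequalities for the exponential. -/

section ScalarBounds

/-- Third-order Taylor remainder; `2/9` is `4 / (3! · 3)`. -/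
lemma exp_neg_lower {y : ℝ} (hy : |y| ≤ 1) :
    1 - y + y ^ 2 / 2 - 2 / 9 * |y| ^ 3 ≤ Real.exp (-y) := by
  have h := Real.exp_bound (x := -y) (by simpa using hy) (n := 3) (by norm_num)
  have h2 := (abs_le.1 h).1
  simp [Finset.sum_range_succ, Nat.factorial] at h2
  nlinarith [h2]

/-- A quadratic majorant of `y ↦ 1 / (e^{-y} - 1 + w)` near the origin. -/
lemma inv_exp_neg_sub_le {w y ε : ℝ} (hw : 0 < w) (hw1 : w ≤ 1) (hy : |y| ≤ ε)
    (hε : 5 * ε < w) :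
    0 < Real.exp (-y) - 1 + w ∧
    1 / (Real.exp (-y) - 1 + w) ≤
      1 / w + y / w ^ 2 + (2 - w) / (2 * w ^ 3 * (1 - 5 * ε / w)) * y ^ 2 := by
  -- In the scale `y = w x` the claim becomes `1 / (1 - x + w x²/2 - …) ≤ 1 + x + (1 - w/2) x² (1 +
  -- 5|x|)` for `|x| < 1/5`. The factor `1 + 5|x|` pays for all higher orders and is the origin of
  -- the `5` in `beta₂`.
  obtain ⟨x, rfl⟩ : ∃ x, y = w * x := ⟨y / w, by field_simp⟩
  have hax : |w * x| = w * |x| := by rw [abs_mul, abs_of_pos hw]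
  rw [hax] at hy
  have hx5 : |x| < 1 / 5 := by
    by_contra hcon
    push Not at hcon
    nlinarith
  have hx0 := abs_nonneg x
  have hpos : 0 < Real.exp (-(w * x)) - 1 + w := by
    have := Real.add_one_le_exp (-(w * x))
    nlinarith [le_abs_self x]
  refine ⟨hpos, ?_⟩
  have hlow := exp_neg_lower (y := w * x) (by rw [hax]; nlinarith)
  rw [hax] at hlow
  set e : ℝ := 2 / 9 * w ^ 2 * |x| ^ 3 with he
  have hew : 1 - x + w * x ^ 2 / 2 - e ≤ (Real.exp (-(w * x)) - 1 + w) / w := by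
    rw [le_div_iff₀ hw, he]
    nlinarith [hlow]
  have hx3 : 0 ≤ |x| ^ 3 := by positivity
  have he0 : 0 ≤ e := by positivity
  have he1 : e ≤ 2 / 9 * |x| ^ 3 := by
    rw [he]
    have : w ^ 2 ≤ 1 := by nlinarith
    nlinarith
  have hx2 : |x| ^ 2 ≤ 1 / 25 := by nlinarith
  have he2 : e ≤ 2 / 225 * |x| := by
    have : |x| ^ 3 = |x| ^ 2 * |x| := by ring
    nlinarith
  set C : ℝ := 1 - w / 2 with hC
  have hC1 : 1 / 2 ≤ C := by rw [hC]; linarith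
  have hC2 : C ≤ 1 := by rw [hC]; linarith
  set q : ℝ := 1 + x + C * x ^ 2 * (1 + 5 * |x|) with hq
  have hsq : |x| ^ 2 = x ^ 2 := sq_abs x
  have hmain : 1 ≤ (1 - x + w * x ^ 2 / 2 - e) * q := by
    have hexp : (1 - x + w * x ^ 2 / 2 - e) * q - 1 =
        C * x ^ 2 * ((1 + 5 * |x|) * (1 - x + w * x ^ 2 / 2 - e) - 1) + w * x ^ 3 / 2
          - e * (1 + x) := by
      rw [hq, hC]; ring
    have hin : 3 / 2 * |x| + (|x| - x) ≤
        (1 + 5 * |x|) * (1 - x + w * x ^ 2 / 2 - e) - 1 := by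
      have hxx := le_abs_self x
      have h1 : 0 ≤ w * x ^ 2 / 2 := by positivity
      have h2 : (1 + 5 * |x|) * (1 - x - e) ≤
        (1 + 5 * |x|) * (1 - x + w * x ^ 2 / 2 - e) := by
        apply mul_le_mul_of_nonneg_left <;> linarith
      have h3 : |x| * x ≤ 1 / 5 * |x| := by
        rw [mul_comm]; exact mul_le_mul_of_nonneg_right (by linarith) hx0
      have h4 : |x| * e ≤ 1 / 5 * e := mul_le_mul_of_nonneg_right hx5.le he0
      linarith
    have h5 : C * x ^ 2 * (3 / 2 * |x| + (|x| - x)) ≤ C * x ^ 2 *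
        ((1 + 5 * |x|) * (1 - x + w * x ^ 2 / 2 - e) - 1) :=
      mul_le_mul_of_nonneg_left hin (by positivity)
    have h6 : 1 / 2 * x ^ 2 * (3 / 2 * |x| + (|x| - x)) ≤
        C * x ^ 2 * (3 / 2 * |x| + (|x| - x)) := by
      have : 0 ≤ x ^ 2 * (3 / 2 * |x| + (|x| - x)) := by
        have := le_abs_self x
        apply mul_nonneg (sq_nonneg _); linarith
      have := mul_le_mul_of_nonneg_right hC1 this
      linarith
    have h7 : e * (1 + x) ≤ 2 / 9 * |x| ^ 3 * (6 / 5) := by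
      have := le_abs_self x
      have := neg_abs_le x
      apply mul_le_mul he1 <;> linarith
    -- The cubic term `w x³/2` helps for `x ≥ 0`; for `x < 0` it is paid for by `|x| - x = 2|x|` in
    -- `h6`.
    rcases le_or_gt 0 x with h0 | h0
    · rw [abs_of_nonneg h0] at *
      have : 0 ≤ w * x ^ 3 / 2 := by positivity
      linarith
    · rw [abs_of_neg h0] at *
      have : 0 ≤ (1 - w) * (-x) ^ 3 := mul_nonneg (by linarith) hx3
      linarith
  have hqpos : 0 ≤ q := by
    have := neg_abs_le x
    have : 0 ≤ C * x ^ 2 * (1 + 5 * |x|) := by positivity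
    rw [hq]; linarith
  have h8 : 1 / ((Real.exp (-(w * x)) - 1 + w) / w) ≤ q := by
    rw [div_le_iff₀ (by positivity)]
    nlinarith [mul_le_mul_of_nonneg_right hew hqpos]
  have hε' : 0 < 1 - 5 * ε / w := by
    rw [sub_pos, div_lt_one hw]; exact hε
  have hxε : |x| ≤ ε / w := by rw [le_div_iff₀ hw]; linarith
  have h9 : 1 + 5 * |x| ≤ 1 / (1 - 5 * ε / w) := by
    rw [le_div_iff₀ hε']
    have : 5 * ε / w = 5 * (ε / w) := by ring
    rw [this] at *
    nlinarith
  have h10 : q ≤ 1 + x + C * x ^ 2 * (1 / (1 - 5 * ε / w)) := by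
    rw [hq]
    have := mul_le_mul_of_nonneg_left h9 (show 0 ≤ C * x ^ 2 by positivity)
    linarith
  have h11 : 1 / (Real.exp (-(w * x)) - 1 + w) =
      1 / ((Real.exp (-(w * x)) - 1 + w) / w) / w := by
    field_simp
  rw [h11]
  calc _ ≤ (1 + x + C * x ^ 2 * (1 / (1 - 5 * ε / w))) / w := by
        gcongr; exact h8.trans h10
    _ = _ := by
        rw [hC]; field_simp

/-- The scalar inequality behind Bernstein's inequality. -/
lemma exp_le_bernstein {y ε : ℝ} (hy : y ≤ ε) (hε : 0 ≤ ε) (hε3 : ε < 3) :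
    Real.exp y ≤ 1 + y + y ^ 2 / (2 * (1 - ε / 3)) := by
  have hmono : ∀ z : ℝ, 0 ≤ z → z ≤ ε → y ^ 2 / (2 * (1 - z / 3)) ≤
      y ^ 2 / (2 * (1 - ε / 3)) := by
    intro z hz hzε
    apply div_le_div_of_nonneg_left (sq_nonneg _) <;> linarith
  rcases le_or_gt 0 y with h0 | h0
  · refine le_trans ?_ (add_le_add_right (hmono y h0 hy) (1 + y))
    -- For nonnegative arguments, majorant times `e^{-z}` equals `1` at `0` and has a nonnegative
    -- derivative.
    have hd : ∀ z ∈ Set.Ico (0 : ℝ) 3, HasDerivAt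
        (fun z : ℝ => (1 + z + z ^ 2 / (2 * (1 - z / 3))) * Real.exp (-z))
        (z ^ 3 / (2 * (3 - z) ^ 2) * Real.exp (-z)) z := by
      intro z hz
      have hz3 : (3 - z) ≠ 0 := by linarith [hz.2]
      have hz3' : (1 - z / 3) ≠ 0 := by intro h; apply hz3; linarith
      have h1 : HasDerivAt (fun z : ℝ => 2 * (1 - z / 3)) (2 * (0 - 1 / 3)) z :=
        (((hasDerivAt_const z (1 : ℝ)).sub ((hasDerivAt_id z).div_const 3)).const_mul 2)
      have h2 := ((((hasDerivAt_const z (1 : ℝ)).add (hasDerivAt_id z)).add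
        ((hasDerivAt_pow 2 z).div h1 (by positivity))).mul
          ((hasDerivAt_id z).neg.exp))
      refine HasDerivAt.congr_deriv (f := fun z : ℝ =>
        (1 + z + z ^ 2 / (2 * (1 - z / 3))) * Real.exp (-z)) h2 ?_
      simp only [Pi.add_apply, Pi.neg_apply, Pi.div_apply, id]
      have h3' : (1 - z / 3) = (3 - z) / 3 := by ring
      rw [h3']
      field_simp
      push_cast
      ring
    have hmon : MonotoneOn
        (fun z : ℝ => (1 + z + z ^ 2 / (2 * (1 - z / 3))) * Real.exp (-z))
        (Set.Ico 0 3) := by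
      apply monotoneOn_of_deriv_nonneg (convex_Ico 0 3)
      · exact fun z hz => (hd z hz).continuousAt.continuousWithinAt
      · exact fun z hz => (hd z (interior_subset hz)).differentiableAt.differentiableWithinAt
      · intro z hz
        have hz' := interior_subset hz
        rw [(hd z hz').deriv]
        have : 0 ≤ z := hz'.1
        positivity
    have := hmon ⟨le_rfl, by norm_num⟩ ⟨h0, by linarith⟩ h0
    simp only [Real.exp_neg] at this
    have hp := Real.exp_pos y
    rw [← div_eq_mul_inv, ← div_eq_mul_inv, le_div_iff₀ hp] at this
    simpa using this
  · have h1 := hmono 0 le_rfl hε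
    have hlow : Real.exp y ≤ 1 + y + y ^ 2 / 2 := by
      have h2 := Real.quadratic_le_exp_of_nonneg (x := -y) (by linarith)
      have h3 : Real.exp y * Real.exp (-y) = 1 := by rw [← Real.exp_add]; simp
      have h4 := Real.exp_pos y
      have h5 : (0 : ℝ) < 1 + -y + (-y) ^ 2 / 2 := by nlinarith
      have h6 : Real.exp y * (1 + -y + (-y) ^ 2 / 2) ≤ 1 := by
        exact (mul_le_mul_of_nonneg_left h2 h4.le).trans h3.le
      -- The product is exactly `1 + y⁴/4`.
      have h7 : 1 ≤ (1 + y + y ^ 2 / 2) * (1 + -y + (-y) ^ 2 / 2) := by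
        nlinarith [sq_nonneg (y ^ 2)]
      by_contra hcon
      push Not at hcon
      nlinarith
    simp at h1
    linarith

end ScalarBounds

/-! ### Norm bounds for multiplied transition operators. -/

section TransferOperator

variable {E : Type*} [Fintype E]

/-- The form inequality `(1-κ)Π + κI ≤ ρ a` says that the diagonal form `ρ a - κ` dominates a
rank-one form. Cauchy–Schwarz with weight `ρ a - κ` reduces this to the scalar condition `hsum`. -/
lemma leon_perron_bound {h a : E → ℝ} (hpos : ∀ y, 0 < h y) {κ ρ : ℝ} (hκ1 : κ < 1)
    (hlt : ∀ y, κ < ρ * a y) (hsum : (1 - κ) * ∑ y, h y / (ρ * a y - κ) ≤ 1) (W : E → ℝ) :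
    (1 - κ) * (∑ y, h y * W y) ^ 2 + κ * ∑ y, h y * W y ^ 2 ≤
      ρ * ∑ y, h y * (a y * W y ^ 2) := by
  have hd : ∀ y, 0 < ρ * a y - κ := fun y => sub_pos.2 (hlt y)
  have hCS : (∑ y, h y * W y) ^ 2 ≤
      (∑ y, h y * ((ρ * a y - κ) * W y ^ 2)) * ∑ y, h y / (ρ * a y - κ) := by
    apply Finset.sum_sq_le_sum_mul_sum_of_sq_le_mul
    · intro y _
      have := hpos y; have := hd y
      positivity
    · intro y _
      have := hpos y; have := hd y
      positivity
    · intro y _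
      have := (hd y).ne'
      refine Eq.le ?_
      field_simp
  set S := ∑ y, h y * ((ρ * a y - κ) * W y ^ 2) with hS
  have hS0 : 0 ≤ S := Finset.sum_nonneg fun y _ => by
    have := hpos y; have := hd y
    positivity
  have hSe : S = ρ * ∑ y, h y * (a y * W y ^ 2) - κ * ∑ y, h y * W y ^ 2 := by
    rw [hS, Finset.mul_sum, Finset.mul_sum, ← Finset.sum_sub_distrib]
    exact Finset.sum_congr rfl fun y _ => by ring
  have h1 := mul_le_mul_of_nonneg_left hCS (sub_pos.2 hκ1).le
  have h2 := mul_le_mul_of_nonneg_left hsum hS0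
  linarith

lemma sum_mul_mulVec_eq {Q : Matrix E E ℝ} {h : E → ℝ} (hh : IsStationaryLaw Q h)
    (V : E → ℝ) : ∑ y, h y * Q.mulVec V y = ∑ y, h y * V y := by
  simp only [Matrix.mulVec, dotProduct, Finset.mul_sum]
  rw [Finset.sum_comm]
  refine Finset.sum_congr rfl fun x _ => ?_
  rw [← hh.stationary x, Finset.sum_mul]
  exact Finset.sum_congr rfl fun y _ => by ring

lemma mulVec_sub_const {Q : Matrix E E ℝ} (hQ : IsTransition Q) (V : E → ℝ) (c : ℝ) (y : E) :
    Q.mulVec (fun x => V x - c) y = Q.mulVec V y - c := by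
  simp only [Matrix.mulVec, dotProduct, mul_sub, Finset.sum_sub_distrib]
  rw [← Finset.sum_mul, hQ.sum_eq_one, one_mul]

lemma sum_mul_sq_sub_mean {h : E → ℝ} (h1 : ∑ y, h y = 1) (V : E → ℝ) :
    ∑ y, h y * (V y - ∑ x, h x * V x) ^ 2 =
      ∑ y, h y * V y ^ 2 - (∑ y, h y * V y) ^ 2 := by
  set c := ∑ x, h x * V x with hc
  have : ∀ y, h y * (V y - c) ^ 2 = h y * V y ^ 2 - 2 * c * (h y * V y) + c ^ 2 * h y :=
    fun y => by ring
  simp only [this, Finset.sum_add_distrib, Finset.sum_sub_distrib, ← Finset.mul_sum, h1]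
  rw [← hc]; ring

lemma sum_mul_sub_mean {h : E → ℝ} (h1 : ∑ y, h y = 1) (V : E → ℝ) :
    ∑ y, h y * (V y - ∑ x, h x * V x) = 0 := by
  simp only [mul_sub, Finset.sum_sub_distrib, ← Finset.sum_mul, h1]
  ring

lemma weighted_cauchy_schwarz {h : E → ℝ} (hpos : ∀ y, 0 ≤ h y) (U V : E → ℝ) :
    (∑ y, h y * (U y * V y)) ^ 2 ≤ (∑ y, h y * U y ^ 2) * ∑ y, h y * V y ^ 2 := by
  apply Finset.sum_sq_le_sum_mul_sum_of_sq_le_mul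
  · exact fun y _ => mul_nonneg (hpos y) (sq_nonneg _)
  · exact fun y _ => mul_nonneg (hpos y) (sq_nonneg _)
  · exact fun y _ => Eq.le (by ring)

/-- Cauchy–Schwarz for the pairs `(u, √(κA))` and `(v, √(κB))`; it recombines the mean and the
fluctuation parts of a bilinear form. -/
lemma sq_add_le_mul_of_sq_le {u v X A B κ : ℝ} (hA : 0 ≤ A) (hB : 0 ≤ B) (hκ : 0 ≤ κ)
    (hX : X ^ 2 ≤ κ ^ 2 * (A * B)) :
    (u * v + X) ^ 2 ≤ (u ^ 2 + κ * A) * (v ^ 2 + κ * B) := by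
  have h1 : |2 * (u * v) * X| ≤ κ * (u ^ 2 * B + v ^ 2 * A) := by
    apply abs_le_of_sq_le_sq _ (by positivity)
    have h2 := mul_le_mul_of_nonneg_left hX (show 0 ≤ 4 * (u * v) ^ 2 by positivity)
    nlinarith [mul_nonneg (sq_nonneg κ) (sq_nonneg (u ^ 2 * B - v ^ 2 * A))]
  have := (abs_le.1 h1).2
  nlinarith

/-- The norm bound for `e^{sf/2} Q e^{sf/2}`, with `a = e^{-sf}`. -/
lemma transfer_contraction {Q : Matrix E E ℝ} {h a : E → ℝ} (hQ : IsTransition Q)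
    (hh : IsStationaryLaw Q h) (ha : ∀ y, 0 < a y) {κ ρ : ℝ} (hκ : 0 ≤ κ)
    (hnorm : ∀ f : E → ℝ, ∑ y, h y * f y = 0 →
      ∑ y, h y * (Q.mulVec f y) ^ 2 ≤ κ ^ 2 * ∑ y, h y * f y ^ 2)
    (hLP : ∀ W : E → ℝ, (1 - κ) * (∑ y, h y * W y) ^ 2 + κ * ∑ y, h y * W y ^ 2 ≤
      ρ * ∑ y, h y * (a y * W y ^ 2)) (V : E → ℝ) :
    ∑ y, h y * ((a y)⁻¹ * (Q.mulVec V y) ^ 2) ≤ ρ ^ 2 * ∑ y, h y * (a y * V y ^ 2) := by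
  have hp : ∀ y, 0 ≤ h y := fun y => (hh.pos y).le
  set U : E → ℝ := fun y => (a y)⁻¹ * Q.mulVec V y with hU
  set S := ∑ y, h y * ((a y)⁻¹ * (Q.mulVec V y) ^ 2) with hS
  set N := ∑ y, h y * (a y * V y ^ 2) with hN
  set u := ∑ x, h x * U x with hu
  set v := ∑ x, h x * V x with hv
  have hSU : S = ∑ y, h y * (a y * U y ^ 2) := by
    refine Finset.sum_congr rfl fun y _ => ?_
    have := (ha y).ne'
    simp only [hU]
    field_simp
  have hN0 : 0 ≤ N := Finset.sum_nonneg fun y _ =>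
    mul_nonneg (hp y) (mul_nonneg (ha y).le (sq_nonneg _))
  have hS0 : 0 ≤ S := Finset.sum_nonneg fun y _ =>
    mul_nonneg (hp y) (mul_nonneg (inv_nonneg.2 (ha y).le) (sq_nonneg _))
  -- The form `⟨U, QV⟩` splits into the product of the means and a centred part bounded through `κ`.
  -- This uses only the norm of `Q`, not self-adjointness. The choice `U = a⁻¹ QV` makes `⟨U, QV⟩`
  -- equal to both `S` and `⟨aU, U⟩`, so one factor `S` cancels at the end.
  set X := ∑ y, h y * ((U y - u) * (Q.mulVec (fun x => V x - v) y)) with hX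
  have hSX : S = u * v + X := by
    have hQV := sum_mul_mulVec_eq hh V
    have e : ∀ y, h y * ((U y - u) * (Q.mulVec (fun x => V x - v) y)) =
        h y * ((a y)⁻¹ * (Q.mulVec V y) ^ 2) - u * (h y * Q.mulVec V y)
          - v * (h y * U y) + u * v * h y := by
      intro y
      rw [mulVec_sub_const hQ]
      simp only [hU]; ring
    rw [hX]
    simp only [e, Finset.sum_add_distrib, Finset.sum_sub_distrib, ← Finset.mul_sum,
      hh.sum_eq_one]
    rw [hQV, ← hu, ← hv, ← hS]; ring
  have hA := sum_mul_sq_sub_mean hh.sum_eq_one U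
  have hB := sum_mul_sq_sub_mean hh.sum_eq_one V
  rw [← hu] at hA; rw [← hv] at hB
  have hA0 : 0 ≤ ∑ y, h y * (U y - u) ^ 2 :=
    Finset.sum_nonneg fun y _ => mul_nonneg (hp y) (sq_nonneg _)
  have hB0 : 0 ≤ ∑ y, h y * (V y - v) ^ 2 :=
    Finset.sum_nonneg fun y _ => mul_nonneg (hp y) (sq_nonneg _)
  have hX2 : X ^ 2 ≤ κ ^ 2 *
      ((∑ y, h y * (U y - u) ^ 2) * ∑ y, h y * (V y - v) ^ 2) := by
    have h1 := weighted_cauchy_schwarz hp (fun y => U y - u)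
      (fun y => Q.mulVec (fun x => V x - v) y)
    have h2 := hnorm (fun x => V x - v) (sum_mul_sub_mean hh.sum_eq_one V)
    have h3 := mul_le_mul_of_nonneg_left h2 hA0
    calc X ^ 2 ≤ _ := h1
      _ ≤ _ := h3
      _ = _ := by ring
  have hS2 : S ^ 2 ≤ (ρ * S) * (ρ * N) := by
    have h1 := sq_add_le_mul_of_sq_le (u := u) (v := v) hA0 hB0 hκ hX2
    rw [← hSX] at h1
    have hu1 := hLP U
    have hv1 := hLP V
    rw [← hSU] at hu1
    refine h1.trans (mul_le_mul ?_ ?_ (by positivity) ?_)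
    · rw [hA]; linarith
    · rw [hB]; linarith
    · refine le_trans ?_ hu1
      have : u ^ 2 + κ * ∑ y, h y * (U y - u) ^ 2 =
        (1 - κ) * u ^ 2 + κ * ∑ y, h y * U y ^ 2 := by rw [hA]; ring
      rw [← this]; positivity
  rcases hS0.eq_or_lt with h0 | h0
  · rw [← h0]; positivity
  · have : S * S ≤ (ρ ^ 2 * N) * S := by nlinarith
    exact le_of_mul_le_mul_right this h0

/-- Jensen on each row, then stationarity. It makes the supremum defining `kappa` one over a bounded
set. -/
lemma sum_sq_mulVec_le {Q : Matrix E E ℝ} {h : E → ℝ} (hQ : IsTransition Q)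
    (hh : IsStationaryLaw Q h) (f : E → ℝ) :
    ∑ y, h y * (Q.mulVec f y) ^ 2 ≤ ∑ y, h y * f y ^ 2 := by
  rw [← sum_mul_mulVec_eq hh (fun x => f x ^ 2)]
  refine Finset.sum_le_sum fun y _ => mul_le_mul_of_nonneg_left ?_ (hh.pos y).le
  have h1 := sum_mul_sq_sub_mean (h := Q y) (hQ.sum_eq_one y) f
  have h2 : 0 ≤ ∑ x, Q y x * (f x - ∑ x, Q y x * f x) ^ 2 :=
    Finset.sum_nonneg fun x _ => mul_nonneg (hQ.nonneg y x) (sq_nonneg _)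
  simp only [Matrix.mulVec, dotProduct]
  linarith

lemma bddAbove_kappa {Q : Matrix E E ℝ} {h : E → ℝ} (hQ : IsTransition Q)
    (hh : IsStationaryLaw Q h) :
    BddAbove {r | ∃ f : E → ℝ, ∑ y, h y * f y = 0 ∧ ∑ y, h y * f y ^ 2 ≤ 1 ∧
      r = √(∑ y, h y * (Q.mulVec f y) ^ 2)} := by
  refine ⟨1, ?_⟩
  rintro r ⟨f, -, hf, rfl⟩
  rw [Real.sqrt_le_one]
  exact (sum_sq_mulVec_le hQ hh f).trans hf

lemma kappa_nonneg (h : E → ℝ) (Q : Matrix E E ℝ) : 0 ≤ kappa h Q := by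
  apply Real.sSup_nonneg
  rintro r ⟨f, -, -, rfl⟩
  exact Real.sqrt_nonneg _

lemma kappa_bound {Q : Matrix E E ℝ} {h : E → ℝ} (hQ : IsTransition Q)
    (hh : IsStationaryLaw Q h) (f : E → ℝ) (hf : ∑ y, h y * f y = 0) :
    ∑ y, h y * (Q.mulVec f y) ^ 2 ≤ kappa h Q ^ 2 * ∑ y, h y * f y ^ 2 := by
  set N := ∑ y, h y * f y ^ 2 with hN
  have hN0 : 0 ≤ N := Finset.sum_nonneg fun y _ => mul_nonneg (hh.pos y).le (sq_nonneg _)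
  rcases hN0.eq_or_lt with h0 | h0
  · have := sum_sq_mulVec_le hQ hh f
    rw [← hN, ← h0] at this
    rw [← h0]; linarith
  · have hs : 0 < √N := Real.sqrt_pos.2 h0
    have hmem : √(∑ y, h y * (Q.mulVec ((√N)⁻¹ • f) y) ^ 2) ≤ kappa h Q := by
      refine le_csSup (bddAbove_kappa hQ hh) ⟨(√N)⁻¹ • f, ?_, ?_, rfl⟩
      · simp only [Pi.smul_apply, smul_eq_mul, mul_left_comm _ (√N)⁻¹, ← Finset.mul_sum, hf,
          mul_zero]
      · simp only [Pi.smul_apply, smul_eq_mul, mul_pow, mul_left_comm _ ((√N)⁻¹ ^ 2),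
          ← Finset.mul_sum]
        rw [← hN, inv_pow, Real.sq_sqrt hN0, inv_mul_cancel₀ h0.ne']
    rw [Real.sqrt_le_left (kappa_nonneg h Q)] at hmem
    simp only [Matrix.mulVec_smul, Pi.smul_apply, smul_eq_mul, mul_pow,
      mul_left_comm _ ((√N)⁻¹ ^ 2), ← Finset.mul_sum] at hmem
    rw [inv_pow, Real.sq_sqrt hN0, inv_mul_le_iff₀ h0] at hmem
    linarith

/-- The backward recursion for the moment generating function of an additive functional. -/
def backward (Q : Matrix E E ℝ) (F : E → ℝ) : ℕ → E → ℝ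
  | 0 => F
  | k + 1 => fun y => F y * Q.mulVec (backward Q F k) y

/-- The initial weight is arbitrary because splitting off the first state leaves a path started from
the row `Q x`. -/
lemma sum_path_eq_backward (Q : Matrix E E ℝ) (F : E → ℝ) (M : ℕ) (h₀ : E → ℝ) :
    ∑ y : Fin (M + 1) → E, (h₀ (y 0) * ∏ i : Fin M, Q (y i.castSucc) (y i.succ)) *
      ∏ i, F (y i) = ∑ x, h₀ x * backward Q F M x := by
  classical
  induction M generalizing h₀ with
  | zero =>
    rw [← (Equiv.funUnique (Fin 1) E).symm.sum_comp]
    simp [backward]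
  | succ M ih =>
    rw [← (Fin.consEquiv (fun _ : Fin (M + 2) => E)).sum_comp, Fintype.sum_prod_type]
    refine Finset.sum_congr rfl fun x _ => ?_
    simp only [backward, Matrix.mulVec, dotProduct]
    rw [← ih (Q x), Finset.mul_sum, Finset.mul_sum]
    refine Finset.sum_congr rfl fun y _ => ?_
    simp only [Fin.consEquiv_apply, Fin.cons_zero]
    rw [Fin.prod_univ_succ, Fin.prod_univ_succ (n := M + 1)]
    simp only [Fin.cons_zero, Fin.cons_succ, Fin.castSucc_zero, ← Fin.succ_castSucc]
    ring

/-- Each backward step costs a factor `ρ` in the `a`-weighted `L²` norm. The two ends of the path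
cost `√Z` each, with `Z = ∑ h a⁻¹ ≤ ρ`, which yields `ρ` to the number of states. -/
lemma sum_backward_le {Q : Matrix E E ℝ} {h a : E → ℝ} (hQ : IsTransition Q)
    (hh : IsStationaryLaw Q h) (ha : ∀ y, 0 < a y) {κ ρ : ℝ} (hκ : 0 ≤ κ) (hρ : 0 ≤ ρ)
    (hnorm : ∀ f : E → ℝ, ∑ y, h y * f y = 0 →
      ∑ y, h y * (Q.mulVec f y) ^ 2 ≤ κ ^ 2 * ∑ y, h y * f y ^ 2)
    (hLP : ∀ W : E → ℝ, (1 - κ) * (∑ y, h y * W y) ^ 2 + κ * ∑ y, h y * W y ^ 2 ≤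
      ρ * ∑ y, h y * (a y * W y ^ 2)) (M : ℕ) :
    ∑ y, h y * backward Q (fun y => (a y)⁻¹) M y ≤ ρ ^ (M + 1) := by
  have hp : ∀ y, 0 ≤ h y := fun y => (hh.pos y).le
  set F : E → ℝ := fun y => (a y)⁻¹ with hF
  set Z := ∑ y, h y * F y with hZ
  have hZ0 : 0 ≤ Z := Finset.sum_nonneg fun y _ => mul_nonneg (hp y) (inv_nonneg.2 (ha y).le)
  have hN : ∀ k, ∑ y, h y * (a y * backward Q F k y ^ 2) ≤ ρ ^ (2 * k) * Z := by
    intro k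
    induction k with
    | zero =>
      simp only [backward, mul_zero, pow_zero, one_mul]
      refine (Finset.sum_congr rfl fun y _ => ?_).le
      have := (ha y).ne'
      simp only [hF]; field_simp
    | succ k ih =>
      have h1 := transfer_contraction hQ hh ha hκ hnorm hLP (backward Q F k)
      have h2 : ∑ y, h y * (a y * backward Q F (k + 1) y ^ 2) =
          ∑ y, h y * ((a y)⁻¹ * (Q.mulVec (backward Q F k) y) ^ 2) := by
        refine Finset.sum_congr rfl fun y _ => ?_
        have := (ha y).ne'
        simp only [backward, hF]; field_simp
      rw [h2]
      calc _ ≤ _ := h1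
        _ ≤ ρ ^ 2 * (ρ ^ (2 * k) * Z) := mul_le_mul_of_nonneg_left ih (sq_nonneg _)
        _ = _ := by ring
  -- Testing `hLP` on `a⁻¹` and using `(∑ h F)² ≤ ∑ h F²` gives `Z² ≤ ρ Z`.
  have hZρ : Z ≤ ρ := by
    have h1 := hLP F
    have h2 := sum_mul_sq_sub_mean hh.sum_eq_one F
    have h3 : 0 ≤ ∑ y, h y * (F y - ∑ x, h x * F x) ^ 2 :=
      Finset.sum_nonneg fun y _ => mul_nonneg (hp y) (sq_nonneg _)
    have h4 : ∑ y, h y * (a y * F y ^ 2) = Z := by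
      refine Finset.sum_congr rfl fun y _ => ?_
      have := (ha y).ne'
      simp only [hF]; field_simp
    rw [h4, ← hZ] at h1
    rw [h2, ← hZ] at h3
    have h5 : Z * Z ≤ ρ * Z := by nlinarith [mul_nonneg hκ h3]
    rcases hZ0.eq_or_lt with h0 | h0
    · rw [← h0]; exact hρ
    · exact le_of_mul_le_mul_right h5 h0
  have hCS : (∑ y, h y * backward Q F M y) ^ 2 ≤ Z *
      ∑ y, h y * (a y * backward Q F M y ^ 2) := by
    apply Finset.sum_sq_le_sum_mul_sum_of_sq_le_mul
    · exact fun y _ => mul_nonneg (hp y) (inv_nonneg.2 (ha y).le)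
    · exact fun y _ => mul_nonneg (hp y) (mul_nonneg (ha y).le (sq_nonneg _))
    · intro y _
      have := (ha y).ne'
      refine Eq.le ?_
      simp only [hF]; field_simp
  have h1 : (∑ y, h y * backward Q F M y) ^ 2 ≤ (ρ ^ M * Z) ^ 2 := by
    refine hCS.trans ((mul_le_mul_of_nonneg_left (hN M) hZ0).trans_eq ?_)
    ring
  calc _ ≤ ρ ^ M * Z := le_of_sq_le_sq h1 (by positivity)
    _ ≤ ρ ^ M * ρ := by gcongr
    _ = _ := by ring

end TransferOperator

/-! ### Bernstein's inequality for stationary Markov chains. -/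

section MarkovBernstein

variable {E : Type*} [Fintype E]

lemma beta₁_pos {κ : ℝ} (hκ : 0 ≤ κ) (hκ1 : κ < 1) : 0 < beta₁ κ :=
  div_pos (by linarith) (by linarith)

lemma beta₂_pos {κ : ℝ} (hκ1 : κ < 1) : 0 < beta₂ κ := by
  unfold beta₂
  split_ifs
  · norm_num
  · exact div_pos (by norm_num) (by linarith)

/-- Verifies the hypotheses of `leon_perron_bound` for `a = e^{-Y}`. A quadratic majorant of the
resolvent is integrated against `h`; its linear term vanishes since `Y` is centred, leaving the
variance. -/
lemma resolvent_sum_le {h Y : E → ℝ} (hpos : ∀ x, 0 < h x) (h1 : ∑ x, h x = 1)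
    (hmean : ∑ x, h x * Y x = 0) {q ε κ : ℝ} (hvar : ∑ x, h x * Y x ^ 2 ≤ q)
    (hY : ∀ x, |Y x| ≤ ε) (hκ : 0 ≤ κ) (hκ1 : κ < 1) (hε0 : 0 ≤ ε)
    (hε : beta₂ κ * ε < 1) :
    (∀ x, κ < (1 + beta₁ κ * q / (2 * (1 - beta₂ κ * ε))) * Real.exp (-Y x)) ∧
    (1 - κ) * ∑ x, h x / ((1 + beta₁ κ * q / (2 * (1 - beta₂ κ * ε))) * Real.exp (-Y x) - κ)
      ≤ 1 := by
  have hq : 0 ≤ q :=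
    (Finset.sum_nonneg fun x _ => mul_nonneg (hpos x).le (sq_nonneg _)).trans hvar
  have hr0 : 0 ≤ beta₁ κ * q / (2 * (1 - beta₂ κ * ε)) := by
    have := beta₁_pos hκ hκ1
    have : 0 < 1 - beta₂ κ * ε := by linarith
    positivity
  set r := beta₁ κ * q / (2 * (1 - beta₂ κ * ε)) with hr
  have hρ : 0 < 1 + r := by linarith
  rcases hκ.eq_or_lt with h0 | h0
  · have hb2 : beta₂ κ = 1 / 3 := by simp [beta₂, ← h0]
    have hb1 : beta₁ κ = 1 := by simp [beta₁, ← h0]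
    rw [hb2] at hε hr
    rw [hb1] at hr
    constructor
    · intro x
      rw [← h0]
      exact mul_pos hρ (Real.exp_pos _)
    · have hsum : ∑ x, h x * Real.exp (Y x) ≤ 1 + r := by
        have hd : 0 < 1 - ε / 3 := by linarith
        calc ∑ x, h x * Real.exp (Y x)
            ≤ ∑ x, h x * (1 + Y x + Y x ^ 2 / (2 * (1 - ε / 3))) :=
              Finset.sum_le_sum fun x _ => mul_le_mul_of_nonneg_left
                (exp_le_bernstein ((le_abs_self _).trans (hY x)) hε0 (by linarith)) (hpos x).le
          _ = 1 + (∑ x, h x * Y x ^ 2) / (2 * (1 - ε / 3)) := by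
              simp only [mul_add, Finset.sum_add_distrib, mul_one, h1, hmean, Finset.sum_div,
                mul_div_assoc, add_zero]
          _ ≤ 1 + r := by
              rw [hr, one_mul, show (1 : ℝ) / 3 * ε = ε / 3 by ring]
              gcongr
      have e : ∀ x, h x / ((1 + r) * Real.exp (-Y x) - κ) = h x * Real.exp (Y x) / (1 + r) := by
        intro x
        rw [← h0, sub_zero, Real.exp_neg]
        field_simp
      simp only [e, ← Finset.sum_div]
      rw [← h0, sub_zero, one_mul, div_le_one hρ]
      exact hsum
  · have hb2 : beta₂ κ = 5 / (1 - κ) := by simp [beta₂, h0.ne']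
    set δ := 1 - κ with hδ
    have hδ0 : 0 < δ := by linarith
    have hδ1 : δ ≤ 1 := by linarith
    rw [hb2] at hε hr
    have hεδ : 5 * ε < δ := by
      rw [div_mul_eq_mul_div, div_lt_one hδ0] at hε; exact hε
    -- Chosen so that `(1 + r) e^{-Y} - κ = (1 + r)(e^{-Y} - 1 + w)`, the shape of
    -- `inv_exp_neg_sub_le`.
    set w := (δ + r) / (1 + r) with hw
    have hρw : (1 + r) * w = δ + r := by rw [hw]; field_simp
    have hδw : δ ≤ w := by rw [hw, le_div_iff₀ hρ]; nlinarith
    have hw0 : 0 < w := by linarith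
    have hw1 : w ≤ 1 := by rw [hw, div_le_one hρ]; linarith
    have hrew : ∀ x, (1 + r) * Real.exp (-Y x) - κ = (1 + r) * (Real.exp (-Y x) - 1 + w) := by
      intro x
      have : κ = 1 - δ := by rw [hδ]; ring
      rw [this, mul_add, hρw]; ring
    have hkey := fun x => inv_exp_neg_sub_le hw0 hw1 (hY x) (by linarith)
    constructor
    · intro x
      have := mul_pos hρ (hkey x).1
      rw [← hrew x] at this
      linarith
    · set C := (2 - w) / (2 * w ^ 3 * (1 - 5 * ε / w)) with hC
      have hεw : 0 < 1 - 5 * ε / w := by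
        rw [sub_pos, div_lt_one hw0]; linarith
      have hC0 : 0 ≤ C := div_nonneg (by linarith) (by positivity)
      have hS : ∑ x, h x / ((1 + r) * Real.exp (-Y x) - κ) ≤ (1 / w + C * q) / (1 + r) := by
        calc _ ≤ ∑ x, h x * (1 / w + Y x / w ^ 2 + C * Y x ^ 2) / (1 + r) := by
              refine Finset.sum_le_sum fun x _ => ?_
              have e : h x / ((1 + r) * Real.exp (-Y x) - κ) =
                  h x * (1 / (Real.exp (-Y x) - 1 + w)) / (1 + r) := by
                have := (hkey x).1.ne'
                rw [hrew]; field_simp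
              rw [e]
              have := mul_le_mul_of_nonneg_left (hkey x).2 (hpos x).le
              gcongr
          _ = (1 / w + C * ∑ x, h x * Y x ^ 2) / (1 + r) := by
              rw [← Finset.sum_div]
              congr 1
              simp only [mul_add, Finset.sum_add_distrib, ← Finset.sum_mul, h1,
                ← mul_div_assoc, ← Finset.sum_div, hmean, mul_left_comm _ C, ← Finset.mul_sum]
              ring
          _ ≤ _ := by gcongr
      refine (mul_le_mul_of_nonneg_left hS hδ0.le).trans ?_
      rw [← mul_div_assoc, div_le_one hρ]
      -- Here `r` is the left side with `w` replaced by `δ`, and that expression decreases in `w ≥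
      -- δ`.
      have hgoal : δ * C * q * w ≤ r := by
        have e1 : δ * C * q * w = q / 2 * ((2 - w) * δ / (w * (w - 5 * ε))) := by
          have : w - 5 * ε ≠ 0 := by linarith
          rw [hC]; field_simp
        have e2 : r = q / 2 * ((2 - δ) / (δ - 5 * ε)) := by
          have h5 : δ - 5 * ε ≠ 0 := by linarith
          have h6 : 1 - 5 / δ * ε ≠ 0 := by
            rw [show 1 - 5 / δ * ε = (δ - 5 * ε) / δ by field_simp]
            positivity
          rw [hr, beta₁, ← hδ, show 1 + κ = 2 - δ by rw [hδ]; ring,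
            show 1 - 5 / δ * ε = (δ - 5 * ε) / δ by field_simp]
          field_simp
        rw [e1, e2]
        refine mul_le_mul_of_nonneg_left ?_ (by positivity)
        rw [div_le_div_iff₀ (mul_pos hw0 (by linarith)) (by linarith), mul_assoc]
        refine mul_le_mul (by linarith) ?_ (mul_nonneg hδ0.le (by linarith)) (by linarith)
        exact mul_le_mul hδw (by linarith) (by linarith) hw0.le
      have e3 : δ * (1 / w + C * q) = (δ + δ * C * q * w) / w := by field_simp
      rw [e3, div_le_iff₀ hw0, hρw]
      linarith

variable {Ω : Type*} [MeasurableSpace Ω] {μ : Measure Ω} [IsProbabilityMeasure μ]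
  [MeasurableSpace E] [MeasurableSingletonClass E]

lemma integral_comp_finite {M : ℕ} {Y : Fin M → Ω → E} (hY : ∀ i, Measurable (Y i))
    (F : (Fin M → E) → ℝ) :
    ∫ ω, F (fun i => Y i ω) ∂μ = ∑ y, μ.real {ω | ∀ i, Y i ω = y i} * F y := by
  have hm : Measurable fun ω => fun i => Y i ω := measurable_pi_lambda _ hY
  have : IsProbabilityMeasure (μ.map fun ω => fun i => Y i ω) :=
    Measure.isProbabilityMeasure_map hm.aemeasurable
  rw [← integral_map (φ := fun ω => fun i => Y i ω) hm.aemeasurable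
    (measurable_of_finite F).aestronglyMeasurable,
    integral_fintype (Integrable.of_finite)]
  refine Finset.sum_congr rfl fun y _ => ?_
  rw [map_measureReal_apply hm (measurableSet_singleton y), smul_eq_mul]
  congr 2
  ext ω
  simp [funext_iff]

omit [Fintype E] [IsProbabilityMeasure μ] [MeasurableSingletonClass E] in
lemma IsMarkovChain.law {M : ℕ} {Q : Matrix E E ℝ} {h : E → ℝ} {Y : Fin (M + 1) → Ω → E}
    (hY : IsMarkovChain μ Q h Y) (y : Fin (M + 1) → E) :
    μ.real {ω | ∀ i, Y i ω = y i} = h (y 0) * ∏ i : Fin M, Q (y i.castSucc) (y i.succ) := by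
  -- `Fin.ofNat` makes the indices total; the reduction modulo `M + 1` is vacuous in the range used.
  have key : ∀ k, k ≤ M → μ.real {ω | ∀ i : Fin (M + 1), i.val ≤ k → Y i ω = y i} =
      h (y 0) * ∏ j ∈ Finset.range k, Q (y (Fin.ofNat (M + 1) j)) (y (Fin.ofNat (M + 1) (j + 1))) := by
    intro k
    induction k with
    | zero =>
      intro _
      rw [Finset.prod_range_zero, mul_one, ← hY.init (Nat.succ_pos M) (y 0)]
      congr 1
      ext ω
      constructor
      · exact fun H => H 0 le_rfl
      · intro H i hi
        have : i = 0 := Fin.ext (Nat.le_zero.1 hi)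
        rw [this]; exact H
    | succ k ih =>
      intro hk
      rw [hY.step k (Nat.lt_succ_of_le hk) y, ih (Nat.le_of_succ_le hk), Finset.prod_range_succ,
        mul_assoc]
      congr 4
      · congr 1
        simp [Nat.mod_eq_of_lt (show k < M + 1 by omega)]
      · congr 1
        simp [Nat.mod_eq_of_lt (show k + 1 < M + 1 by omega)]
  have h1 := key M le_rfl
  have h2 : {ω | ∀ i : Fin (M + 1), i.val ≤ M → Y i ω = y i} = {ω | ∀ i, Y i ω = y i} := by
    ext ω
    exact forall_congr' fun i => ⟨fun H => H (Nat.lt_succ_iff.1 i.2), fun H _ => H⟩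
  rw [← h2, h1, Finset.prod_range]
  congr 1
  refine Finset.prod_congr rfl fun i _ => ?_
  congr 2
  · ext
    simp [Fin.ofNat, Nat.mod_eq_of_lt (show i.val < M + 1 by omega)]
  · ext
    simp [Fin.ofNat, Nat.mod_eq_of_lt (show i.val + 1 < M + 1 by omega)]

lemma chain_mgf_le {m : ℕ} (hm : 0 < m) {Q : Matrix E E ℝ} {h : E → ℝ} (hQ : IsTransition Q)
    (hh : IsStationaryLaw Q h) {Y : Fin m → Ω → E} (hY : IsMarkovChain μ Q h Y)
    (hκ1 : kappa h Q < 1) {Z : E → ℝ} (hmean : ∑ x, h x * Z x = 0) {q ε : ℝ}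
    (hvar : ∑ x, h x * Z x ^ 2 ≤ q) (hZ : ∀ x, |Z x| ≤ ε) (hε0 : 0 ≤ ε)
    (hε : beta₂ (kappa h Q) * ε < 1) :
    ∫ ω, Real.exp (∑ i, Z (Y i ω)) ∂μ ≤
      (1 + beta₁ (kappa h Q) * q / (2 * (1 - beta₂ (kappa h Q) * ε))) ^ m := by
  obtain ⟨M, rfl⟩ := Nat.exists_eq_succ_of_ne_zero hm.ne'
  have hκ := kappa_nonneg h Q
  obtain ⟨hlt, hres⟩ := resolvent_sum_le hh.pos hh.sum_eq_one hmean hvar hZ hκ hκ1 hε0 hε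
  have hLP := leon_perron_bound hh.pos hκ1 hlt hres
  have hq : 0 ≤ q :=
    (Finset.sum_nonneg fun x _ => mul_nonneg (hh.pos x).le (sq_nonneg _)).trans hvar
  have hρ : 0 ≤ 1 + beta₁ (kappa h Q) * q / (2 * (1 - beta₂ (kappa h Q) * ε)) := by
    have := beta₁_pos hκ hκ1
    have : 0 < 1 - beta₂ (kappa h Q) * ε := by linarith
    positivity
  have hb := sum_backward_le hQ hh (fun y => Real.exp_pos (-Z y)) hκ hρ (kappa_bound hQ hh)
    hLP M
  refine le_trans (le_of_eq ?_) hb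
  rw [← sum_path_eq_backward]
  rw [integral_comp_finite hY.measurable (fun y => Real.exp (∑ i, Z (y i)))]
  refine Finset.sum_congr rfl fun y _ => ?_
  rw [hY.law y, Real.exp_sum]
  simp only [Real.exp_neg, inv_inv]

/-- **Bernstein's inequality** for a stationary Markov chain with absolute spectral gap. -/
theorem chain_bernstein {m : ℕ} (hm : 0 < m) {Q : Matrix E E ℝ} {h : E → ℝ}
    (hQ : IsTransition Q) (hh : IsStationaryLaw Q h) {Y : Fin m → Ω → E}
    (hY : IsMarkovChain μ Q h Y) (hκ1 : kappa h Q < 1) {f : E → ℝ}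
    (hmean : ∑ x, h x * f x = 0) {v c t : ℝ} (hvar : ∑ x, h x * f x ^ 2 ≤ v)
    (hf : ∀ x, |f x| ≤ c) (hc : 0 < c) (ht : 0 < t) :
    μ.real {ω | m * t ≤ ∑ i, f (Y i ω)} ≤
      Real.exp (-(m * t ^ 2 / (2 * (beta₁ (kappa h Q) * v + beta₂ (kappa h Q) * c * t)))) := by
  have hκ := kappa_nonneg h Q
  have hb1 := beta₁_pos hκ hκ1
  have hb2 := beta₂_pos hκ1
  set β₁ := beta₁ (kappa h Q) with hβ₁
  set β₂ := beta₂ (kappa h Q) with hβ₂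
  have hv : 0 ≤ v :=
    (Finset.sum_nonneg fun x _ => mul_nonneg (hh.pos x).le (sq_nonneg _)).trans hvar
  set D := β₁ * v + β₂ * c * t with hD
  have hD0 : 0 < D := by positivity
  -- With this Chernoff parameter `1 - β₂ s c = β₁ v / D`, so the logarithm of the moment generating
  -- function is at most `m t s / 2`, half of the Chernoff gain `m t s`.
  set s := t / D with hs
  have hs0 : 0 < s := div_pos ht hD0
  have hε : β₂ * (s * c) ≤ 1 - β₁ * v / D := by
    rw [hs]
    have : 1 - β₁ * v / D = (D - β₁ * v) / D := by field_simp
    rw [this, hD]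
    refine Eq.le ?_
    field_simp
    ring
  have hsm : Measurable fun ω => ∑ i, f (Y i ω) :=
    Finset.measurable_sum _ fun i _ => (measurable_of_finite f).comp (hY.measurable i)
  have hint : Integrable (fun ω => Real.exp (s * ∑ i, f (Y i ω))) μ := by
    refine Integrable.of_bound (Measurable.aestronglyMeasurable (by fun_prop))
      (Real.exp (s * (m * c))) (Filter.Eventually.of_forall fun ω => ?_)
    rw [Real.norm_eq_abs, abs_of_pos (Real.exp_pos _), Real.exp_le_exp]
    refine mul_le_mul_of_nonneg_left ?_ hs0.le
    calc ∑ i, f (Y i ω) ≤ ∑ _i : Fin m, c :=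
          Finset.sum_le_sum fun i _ => (le_abs_self _).trans (hf _)
      _ = m * c := by simp
  have hcher := measure_ge_le_exp_mul_mgf (μ := μ) (X := fun ω => ∑ i, f (Y i ω))
    (m * t) hs0.le hint
  have hb : mgf (fun ω => ∑ i, f (Y i ω)) μ s ≤ Real.exp (m * (t * s / 2)) := by
    -- When `v = 0` the strict condition `β₂ s c < 1` fails, but then `f` vanishes identically.
    rcases hv.eq_or_lt with hv0 | hv0
    · have hf0 : ∀ x, f x = 0 := by
        intro x
        have h1 : ∑ x, h x * f x ^ 2 = 0 := le_antisymm (hvar.trans hv0.symm.le)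
          (Finset.sum_nonneg fun x _ => mul_nonneg (hh.pos x).le (sq_nonneg _))
        rw [Finset.sum_eq_zero_iff_of_nonneg
          (fun x _ => mul_nonneg (hh.pos x).le (sq_nonneg _))] at h1
        have := h1 x (Finset.mem_univ x)
        have h3 := (hh.pos x).ne'
        simpa [h3] using this
      simp only [mgf, hf0, Finset.sum_const_zero, mul_zero, Real.exp_zero]
      simp only [integral_const, probReal_univ, smul_eq_mul, mul_one]
      exact Real.one_le_exp (by positivity)
    · have hlt : 0 < β₁ * v / D := by positivity
      have hmgf := chain_mgf_le hm hQ hh hY hκ1 (Z := fun x => s * f x) (q := s ^ 2 * v)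
        (ε := s * c)
        (by simp only [mul_left_comm _ s, ← Finset.mul_sum, hmean, mul_zero])
        (by
          simp only [mul_pow, mul_left_comm _ (s ^ 2), ← Finset.mul_sum]
          exact mul_le_mul_of_nonneg_left hvar (sq_nonneg s))
        (fun x => by
          rw [abs_mul, abs_of_pos hs0]
          exact mul_le_mul_of_nonneg_left (hf x) hs0.le)
        (by positivity) (by linarith)
      rw [← hβ₁, ← hβ₂] at hmgf
      simp only [mgf, Finset.mul_sum]
      refine hmgf.trans ?_
      rw [Real.exp_nat_mul]
      refine pow_le_pow_left₀ ?_ ?_ m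
      · have : 0 < 1 - β₂ * (s * c) := by linarith
        positivity
      · rw [add_comm]
        refine le_trans ?_ (Real.add_one_le_exp _)
        refine add_le_add_left ?_ 1
        have h1 : 0 < 1 - β₂ * (s * c) := by linarith
        calc β₁ * (s ^ 2 * v) / (2 * (1 - β₂ * (s * c)))
            ≤ β₁ * (s ^ 2 * v) / (2 * (β₁ * v / D)) := by
              apply div_le_div_of_nonneg_left <;> first | positivity | linarith
          _ = t * s / 2 := by
              rw [hs]; field_simp
  refine hcher.trans ((mul_le_mul_of_nonneg_left hb (Real.exp_pos _).le).trans_eq ?_)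
  rw [← Real.exp_add]
  congr 1
  rw [hs]
  field_simp
  ring

end MarkovBernstein

/-! ### Means and variances under exponentially tilted weights. -/

noncomputable section TiltedMeans

variable {ι : Type*} [Fintype ι]

/-- The mean of `a` under the normalized weights `w`. -/
def tmean (w a : ι → ℝ) : ℝ := (∑ i, w i * a i) / ∑ i, w i

/-- The variance of `a` under the normalized weights `w`. -/
def tvar (w a : ι → ℝ) : ℝ := tmean w (fun i => a i ^ 2) - tmean w a ^ 2

lemma sum_pos_of_weights [Nonempty ι] {w : ι → ℝ} (hw : ∀ i, 0 < w i) : 0 < ∑ i, w i :=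
  Finset.sum_pos (fun i _ => hw i) Finset.univ_nonempty

lemma tmean_mul_sum [Nonempty ι] {w : ι → ℝ} (hw : ∀ i, 0 < w i) (a : ι → ℝ) :
    tmean w a * ∑ i, w i = ∑ i, w i * a i :=
  div_mul_cancel₀ _ (sum_pos_of_weights hw).ne'

lemma tmean_const_mul (w : ι → ℝ) (c : ℝ) (a : ι → ℝ) :
    tmean w (fun i => c * a i) = c * tmean w a := by
  simp only [tmean, mul_left_comm _ c, ← Finset.mul_sum, mul_div_assoc]

lemma tmean_sum {J : Type*} (s : Finset J) (w : ι → ℝ) (a : J → ι → ℝ) :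
    tmean w (fun i => ∑ j ∈ s, a j i) = ∑ j ∈ s, tmean w (a j) := by
  simp only [tmean, Finset.mul_sum, ← Finset.sum_div]
  rw [Finset.sum_comm]

lemma tvar_const_mul (w : ι → ℝ) (c : ℝ) (a : ι → ℝ) :
    tvar w (fun i => c * a i) = c ^ 2 * tvar w a := by
  simp only [tvar, mul_pow, tmean_const_mul]
  ring

lemma tvar_mul_sum [Nonempty ι] {w : ι → ℝ} (hw : ∀ i, 0 < w i) (a : ι → ℝ) :
    tvar w a * ∑ i, w i = ∑ i, w i * (a i - tmean w a) ^ 2 := by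
  have e : ∀ i, w i * (a i - tmean w a) ^ 2 =
      w i * a i ^ 2 - 2 * tmean w a * (w i * a i) + tmean w a ^ 2 * w i := fun i => by ring
  simp only [e, Finset.sum_add_distrib, Finset.sum_sub_distrib, ← Finset.mul_sum]
  rw [← tmean_mul_sum hw, ← tmean_mul_sum hw, tvar]
  ring

lemma tvar_nonneg [Nonempty ι] {w : ι → ℝ} (hw : ∀ i, 0 < w i) (a : ι → ℝ) :
    0 ≤ tvar w a := by
  have h1 := sum_pos_of_weights hw
  have h2 : 0 ≤ ∑ i, w i * (a i - tmean w a) ^ 2 :=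
    Finset.sum_nonneg fun i _ => mul_nonneg (hw i).le (sq_nonneg _)
  rw [← tvar_mul_sum hw] at h2
  exact nonneg_of_mul_nonneg_left h2 h1

lemma exp_sub_exp_mul_sub_ge {a b l : ℝ} (ha : l ≤ a) (hb : l ≤ b) :
    Real.exp l * (a - b) ^ 2 ≤ (Real.exp a - Real.exp b) * (a - b) := by
  have key : ∀ {a b : ℝ}, l ≤ b → b ≤ a →
      Real.exp l * (a - b) ^ 2 ≤ (Real.exp a - Real.exp b) * (a - b) := by
    intro a b hb hab
    have h1 := Real.add_one_le_exp (a - b)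
    have h2 : Real.exp a = Real.exp b * Real.exp (a - b) := by rw [← Real.exp_add]; ring_nf
    have h3 := Real.exp_le_exp.2 hb
    have h4 : Real.exp l * (a - b) ≤ Real.exp a - Real.exp b := by
      have h5 := mul_le_mul_of_nonneg_left h1 (Real.exp_pos b).le
      have h6 := mul_le_mul_of_nonneg_right h3 (sub_nonneg.2 hab)
      rw [h2]; linarith
    have := mul_le_mul_of_nonneg_right h4 (sub_nonneg.2 hab)
    linarith
  rcases le_total b a with h | h
  · exact key hb h
  · have := key ha h
    linarith

/-- Quantitative monotonicity of the derivative of log-sum-exp. With `b` the untilted mean, the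
numerator is `∑ w (e^a - e^b)(a - b) ≥ e^l ∑ w (a - b)²`, and the tilted mass is at most `e^u ∑ w`.
-/
lemma tmean_tilt_sub_ge [Nonempty ι] {w : ι → ℝ} (hw : ∀ i, 0 < w i) {a : ι → ℝ} {l u : ℝ}
    (hl : ∀ i, l ≤ a i) (hu : ∀ i, a i ≤ u) :
    Real.exp (l - u) * tvar w a ≤
      tmean (fun i => w i * Real.exp (a i)) a - tmean w a := by
  have hw' : ∀ i, 0 < w i * Real.exp (a i) := fun i => mul_pos (hw i) (Real.exp_pos _)
  have hW := sum_pos_of_weights hw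
  have hW' := sum_pos_of_weights hw'
  have hV := tvar_nonneg hw a
  set b := tmean w a with hb
  have hlb : l ≤ b := by
    rw [hb, tmean, le_div_iff₀ hW, Finset.mul_sum]
    exact Finset.sum_le_sum fun i _ => by
      rw [mul_comm]; exact mul_le_mul_of_nonneg_left (hl i) (hw i).le
  have h1 : (tmean (fun i => w i * Real.exp (a i)) a - b) * ∑ i, w i * Real.exp (a i) =
      ∑ i, w i * ((Real.exp (a i) - Real.exp b) * (a i - b)) := by
    have e : ∀ i, w i * ((Real.exp (a i) - Real.exp b) * (a i - b)) =
        w i * Real.exp (a i) * a i - b * (w i * Real.exp (a i)) - Real.exp b * (w i * a i)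
          + Real.exp b * b * w i := fun i => by ring
    simp only [e, Finset.sum_add_distrib, Finset.sum_sub_distrib, ← Finset.mul_sum]
    rw [sub_mul, tmean_mul_sum hw', ← tmean_mul_sum hw a, ← hb]
    ring
  have h2 : Real.exp l * (tvar w a * ∑ i, w i) ≤
      ∑ i, w i * ((Real.exp (a i) - Real.exp b) * (a i - b)) := by
    rw [tvar_mul_sum hw, Finset.mul_sum]
    refine Finset.sum_le_sum fun i _ => ?_
    rw [mul_left_comm]
    exact mul_le_mul_of_nonneg_left (exp_sub_exp_mul_sub_ge (hl i) hlb) (hw i).le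
  have h3 : ∑ i, w i * Real.exp (a i) ≤ Real.exp u * ∑ i, w i := by
    rw [Finset.mul_sum]
    refine Finset.sum_le_sum fun i _ => ?_
    rw [mul_comm]
    exact mul_le_mul_of_nonneg_right (Real.exp_le_exp.2 (hu i)) (hw i).le
  refine le_of_mul_le_mul_right ?_ hW'
  rw [h1]
  refine le_trans ?_ h2
  calc Real.exp (l - u) * tvar w a * ∑ i, w i * Real.exp (a i)
      ≤ Real.exp (l - u) * tvar w a * (Real.exp u * ∑ i, w i) :=
        mul_le_mul_of_nonneg_left h3 (mul_nonneg (Real.exp_pos _).le hV)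
    _ = (Real.exp (l - u) * Real.exp u) * (tvar w a * ∑ i, w i) := by ring
    _ = _ := by rw [← Real.exp_add, sub_add_cancel]

lemma tmean_tilt_mono [Nonempty ι] {w : ι → ℝ} (hw : ∀ i, 0 < w i) (a : ι → ℝ) {c c' : ℝ}
    (hc : c ≤ c') :
    tmean (fun i => w i * Real.exp (c * a i)) a ≤
      tmean (fun i => w i * Real.exp (c' * a i)) a := by
  rcases hc.eq_or_lt with rfl | hlt
  · exact le_rfl
  have hw' : ∀ i, 0 < w i * Real.exp (c * a i) := fun i => mul_pos (hw i) (Real.exp_pos _)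
  have hbd : ∀ i, |(c' - c) * a i| ≤ ∑ k, |(c' - c) * a k| := fun i =>
    Finset.single_le_sum (f := fun k => |(c' - c) * a k|) (fun k _ => abs_nonneg _)
      (Finset.mem_univ i)
  have h1 := tmean_tilt_sub_ge hw' (a := fun i => (c' - c) * a i)
    (fun i => (abs_le.1 (hbd i)).1) (fun i => (abs_le.1 (hbd i)).2)
  have h2 := (mul_nonneg (Real.exp_pos _).le
    (tvar_nonneg hw' (fun i => (c' - c) * a i))).trans h1
  rw [tmean_const_mul, tmean_const_mul, ← mul_sub] at h2
  have h3 := nonneg_of_mul_nonneg_right h2 (sub_pos.2 hlt)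
  have e : (fun i => w i * Real.exp (c * a i) * Real.exp ((c' - c) * a i)) =
      fun i => w i * Real.exp (c' * a i) := by
    funext i
    rw [mul_assoc, ← Real.exp_add]
    ring_nf
  rw [e] at h3
  linarith

/-- Jensen's inequality, from the tangent of `exp` at the mean. -/
lemma tmean_le_log_sum_exp [Nonempty ι] {v : ι → ℝ} (hv : ∀ i, 0 < v i) (b : ι → ℝ) :
    tmean v b ≤ Real.log (∑ i, v i * Real.exp (b i)) - Real.log (∑ i, v i) := by
  have hV := sum_pos_of_weights hv
  have h1 : Real.exp (tmean v b) * ∑ i, v i ≤ ∑ i, v i * Real.exp (b i) := by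
    have h2 : ∀ i, v i * (Real.exp (tmean v b) * (1 + b i - tmean v b)) ≤
        v i * Real.exp (b i) := by
      intro i
      refine mul_le_mul_of_nonneg_left ?_ (hv i).le
      have h3 := Real.add_one_le_exp (b i - tmean v b)
      have h4 : Real.exp (b i) = Real.exp (tmean v b) * Real.exp (b i - tmean v b) := by
        rw [← Real.exp_add]; ring_nf
      rw [h4]
      exact mul_le_mul_of_nonneg_left (by linarith) (Real.exp_pos _).le
    refine le_trans (le_of_eq ?_) (Finset.sum_le_sum fun i _ => h2 i)
    have e : ∀ i, v i * (Real.exp (tmean v b) * (1 + b i - tmean v b)) =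
        Real.exp (tmean v b) * (v i + v i * b i - tmean v b * v i) := fun i => by ring
    simp only [e, ← Finset.mul_sum, Finset.sum_add_distrib, Finset.sum_sub_distrib]
    rw [tmean_mul_sum hv]; ring
  have h5 := Real.log_le_log (mul_pos (Real.exp_pos _) hV) h1
  rw [Real.log_mul (Real.exp_pos _).ne' hV.ne', Real.log_exp] at h5
  linarith

end TiltedMeans

/-! ### The deterministic oracle inequality. -/

section Oracle

variable {E : Type*} {n m p : ℕ}

lemma dot_add_smul (θ η v : Fin p → ℝ) (c : ℝ) :
    dot (fun j => θ j + c * η j) v = dot θ v + c * dot η v := by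
  simp only [dot, Finset.mul_sum, ← Finset.sum_add_distrib]
  exact Finset.sum_congr rfl fun j _ => by ring

lemma abs_dot_le {K : ℝ} {θ v : Fin p → ℝ} (hv : ∀ j, |v j| ≤ K) : |dot θ v| ≤ K * l1 θ := by
  rw [dot, l1, Finset.mul_sum]
  refine (Finset.abs_sum_le_sum_abs _ _).trans (Finset.sum_le_sum fun j _ => ?_)
  rw [abs_mul, mul_comm]
  exact mul_le_mul_of_nonneg_right (hv j) (abs_nonneg _)

lemma l1On_add_compl (T : Finset (Fin p)) (θ : Fin p → ℝ) :
    l1On T θ + l1On Tᶜ θ = l1 θ :=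
  Finset.sum_add_sum_compl T _

lemma l1On_nonneg (T : Finset (Fin p)) (θ : Fin p → ℝ) : 0 ≤ l1On T θ :=
  Finset.sum_nonneg fun _ _ => abs_nonneg _

lemma le_of_forall_small_mul {X Y Z t₀ : ℝ} (ht₀ : 0 < t₀)
    (h : ∀ t, 0 < t → t ≤ t₀ → X ≤ Y + t * Z) : X ≤ Y := by
  refine le_of_forall_pos_le_add fun ε hε => ?_
  have h1 : 0 < |Z| + 1 := by positivity
  have h2 := h (min t₀ (ε / (|Z| + 1))) (lt_min ht₀ (by positivity)) (min_le_left _ _)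
  have h3 : min t₀ (ε / (|Z| + 1)) * Z ≤ ε / (|Z| + 1) * (|Z| + 1) :=
    (mul_le_mul_of_nonneg_left ((le_abs_self Z).trans (by linarith : |Z| ≤ |Z| + 1))
      (lt_min ht₀ (by positivity)).le).trans
      (mul_le_mul_of_nonneg_right (min_le_right _ _) h1.le)
  rw [div_mul_cancel₀ _ h1.ne'] at h3
  linarith

/-- The variational inequality for a minimizer of the elastic-net criterion, tested in the
direction of the true parameter. -/
lemma minimizer_variational (hm : 0 < m) {φ : E → Fin p → ℝ} {h : E → ℝ} (hpos : ∀ y, 0 < h y)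
    {lam₁ lam₂ : ℝ} (hlam₁ : 0 < lam₁) {x : Fin n → E} {y : Fin m → E}
    {θs θh : Fin p → ℝ} (hmin : IsMinOn (enetCriterion φ h lam₁ lam₂ x y) Set.univ θh)
    {c : ℝ} (hc1 : c < 1) :
    tmean (fun i => Real.exp (dot θs (φ (y i))) / h (y i) *
        Real.exp (c * dot (θh - θs) (φ (y i)))) (fun i => dot (θh - θs) (φ (y i))) ≤
      (1 / (n : ℝ)) * ∑ i, dot (θh - θs) (φ (x i)) + lam₁ * (l1 θs - l1 θh) -
        2 * lam₂ * ∑ j, θh j * (θh j - θs j) := by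
  have : Nonempty (Fin m) := ⟨⟨0, hm⟩⟩
  set Δ := θh - θs with hΔ
  set a : Fin m → ℝ := fun i => dot Δ (φ (y i)) with ha
  set w : Fin m → ℝ := fun i => Real.exp (dot θs (φ (y i))) / h (y i) with hw
  have hw0 : ∀ i, 0 < w i := fun i => div_pos (Real.exp_pos _) (hpos _)
  have hwc : ∀ (r : ℝ) i, 0 < w i * Real.exp (r * a i) := fun r i =>
    mul_pos (hw0 i) (Real.exp_pos _)
  -- The minimizer is compared with `θh - tΔ`, and `t → 0` removes the quadratic remainder of the
  -- ridge term. The bound `t ≤ 1 - c` places the comparison point at tilt `1 - t ≥ c`, so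
  -- monotonicity of tilted means replaces differentiation.
  refine le_of_forall_small_mul (Z := lam₂ * ∑ j, Δ j ^ 2) (t₀ := min 1 (1 - c))
    (lt_min one_pos (by linarith)) fun t ht ht₀ => ?_
  have ht1 : t ≤ 1 := ht₀.trans (min_le_left _ _)
  have htc : c ≤ 1 - t := by have := ht₀.trans (min_le_right _ _); linarith
  refine (tmean_tilt_mono hw0 a htc).trans ?_
  set θt : Fin p → ℝ := fun j => θh j + (-t) * Δ j with hθt
  have hQ : enetCriterion φ h lam₁ lam₂ x y θh ≤ enetCriterion φ h lam₁ lam₂ x y θt :=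
    hmin (Set.mem_univ θt)
  have hS : ∀ r : ℝ, ∑ i, Real.exp (dot (fun j => θh j + (-r) * Δ j) (φ (y i))) / h (y i) =
      ∑ i, w i * Real.exp ((1 - r) * a i) := by
    intro r
    refine Finset.sum_congr rfl fun i _ => ?_
    have e : dot (fun j => θh j + (-r) * Δ j) (φ (y i)) =
        dot θs (φ (y i)) + (1 - r) * a i := by
      rw [ha, ← dot_add_smul]
      congr 1
      funext j
      simp only [hΔ, Pi.sub_apply]; ring
    rw [e, Real.exp_add]
    simp only [hw]; ring
  have hS0 : ∑ i, Real.exp (dot θh (φ (y i))) / h (y i) = ∑ i, w i * Real.exp (1 * a i) := by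
    have := hS 0
    simpa using this
  have hlin : (1 / (n : ℝ)) * ∑ i, dot θt (φ (x i)) = (1 / (n : ℝ)) * ∑ i, dot θh (φ (x i))
      - t * ((1 / (n : ℝ)) * ∑ i, dot Δ (φ (x i))) := by
    simp only [hθt, dot_add_smul, Finset.sum_add_distrib, ← Finset.mul_sum]
    ring
  have hl1 : l1 θt ≤ (1 - t) * l1 θh + t * l1 θs := by
    simp only [l1, Finset.mul_sum, ← Finset.sum_add_distrib]
    refine Finset.sum_le_sum fun j _ => ?_
    have e : θt j = (1 - t) * θh j + t * θs j := by
      simp only [hθt, hΔ, Pi.sub_apply]; ring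
    rw [e]
    refine (abs_add_le _ _).trans_eq ?_
    rw [abs_mul, abs_mul, abs_of_nonneg (by linarith : 0 ≤ 1 - t), abs_of_pos ht]
  have hl2 : ∑ j, θt j ^ 2 = ∑ j, θh j ^ 2 - 2 * t * ∑ j, θh j * (θh j - θs j)
      + t ^ 2 * ∑ j, Δ j ^ 2 := by
    simp only [Finset.mul_sum, ← Finset.sum_add_distrib, ← Finset.sum_sub_distrib]
    refine Finset.sum_congr rfl fun j _ => ?_
    simp only [hθt, hΔ, Pi.sub_apply]; ring
  have hlog := tmean_le_log_sum_exp (hwc (1 - t)) (fun i => t * a i)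
  rw [tmean_const_mul] at hlog
  have e1 : ∑ i, w i * Real.exp ((1 - t) * a i) * Real.exp (t * a i) =
      ∑ i, w i * Real.exp (1 * a i) := by
    refine Finset.sum_congr rfl fun i _ => ?_
    rw [mul_assoc, ← Real.exp_add]; ring_nf
  rw [e1] at hlog
  have hm' : (1 / (m : ℝ)) ≠ 0 := by positivity
  simp only [enetCriterion, mcLoss] at hQ
  rw [hS0, hθt, hS t, ← hθt, hlin, hl2,
    Real.log_mul hm' (sum_pos_of_weights (hwc _)).ne',
    Real.log_mul hm' (sum_pos_of_weights (hwc _)).ne'] at hQ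
  have hl1' := mul_le_mul_of_nonneg_left hl1 hlam₁.le
  refine le_of_mul_le_mul_left ?_ ht
  linarith

/-- Off the support `θs` vanishes, so the lasso term gains the full `ℓ₁` norm there and the ridge
term is harmless. On the support `-θh Δ = -Δ² - θs Δ ≤ B |Δ|`. -/
lemma penalty_difference_le {B lam₁ lam₂ : ℝ} (hlam₁ : 0 < lam₁) (hlam₂ : 0 < lam₂)
    {θs θh : Fin p → ℝ} (hθB : ∀ j, |θs j| ≤ B) :
    lam₁ * (l1 θs - l1 θh) - 2 * lam₂ * ∑ j, θh j * (θh j - θs j) ≤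
      (lam₁ + 2 * lam₂ * B) * l1On (supp θs) (θh - θs) -
        lam₁ * l1On (supp θs)ᶜ (θh - θs) := by
  have h1 : l1 θs - l1 θh ≤ l1On (supp θs) (θh - θs) - l1On (supp θs)ᶜ (θh - θs) := by
    rw [← l1On_add_compl (supp θs) θs, ← l1On_add_compl (supp θs) θh]
    have hA : l1On (supp θs) θs ≤ l1On (supp θs) θh + l1On (supp θs) (θh - θs) := by
      simp only [l1On, ← Finset.sum_add_distrib]
      refine Finset.sum_le_sum fun j _ => ?_
      have := abs_sub_abs_le_abs_sub (θs j) (θh j)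
      rw [abs_sub_comm] at this
      simp only [Pi.sub_apply]; linarith
    have hB : l1On (supp θs)ᶜ θs + l1On (supp θs)ᶜ (θh - θs) ≤ l1On (supp θs)ᶜ θh := by
      simp only [l1On, ← Finset.sum_add_distrib]
      refine Finset.sum_le_sum fun j hj => ?_
      have : θs j = 0 := by simpa [supp] using hj
      simp [this]
    linarith
  have h2 : -∑ j, θh j * (θh j - θs j) ≤ B * l1On (supp θs) (θh - θs) := by
    rw [← Finset.sum_neg_distrib, ← Finset.sum_add_sum_compl (supp θs), l1On, Finset.mul_sum]
    have hA : ∑ j ∈ supp θs, -(θh j * (θh j - θs j)) ≤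
        ∑ j ∈ supp θs, B * |(θh - θs) j| := by
      refine Finset.sum_le_sum fun j _ => ?_
      simp only [Pi.sub_apply]
      have h3 : -(θs j * (θh j - θs j)) ≤ |θs j| * |θh j - θs j| := by
        rw [← abs_mul]; exact neg_le_abs _
      have h4 := mul_le_mul_of_nonneg_right (hθB j) (abs_nonneg (θh j - θs j))
      nlinarith [sq_nonneg (θh j - θs j)]
    have hB : ∑ j ∈ (supp θs)ᶜ, -(θh j * (θh j - θs j)) ≤ 0 := by
      refine Finset.sum_nonpos fun j hj => ?_
      have : θs j = 0 := by simpa [supp] using hj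
      rw [this]; nlinarith [sq_nonneg (θh j)]
    linarith
  have h3 := mul_le_mul_of_nonneg_left h1 hlam₁.le
  have h4 := mul_le_mul_of_nonneg_left h2 hlam₂.le
  linarith

lemma abs_tmean_dot_sub_le {ι : Type*} [Fintype ι] {w : ι → ℝ} {v : ι → Fin p → ℝ}
    {u : Fin n → Fin p → ℝ} {τ : ℝ}
    (hgrad : ∀ j, |tmean w (fun i => v i j) - (1 / (n : ℝ)) * ∑ i, u i j| ≤ τ)
    (Δ : Fin p → ℝ) :
    |tmean w (fun i => dot Δ (v i)) - (1 / (n : ℝ)) * ∑ i, dot Δ (u i)| ≤ τ * l1 Δ := by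
  have e : tmean w (fun i => dot Δ (v i)) - (1 / (n : ℝ)) * ∑ i, dot Δ (u i) =
      dot Δ (fun j => tmean w (fun i => v i j) - (1 / (n : ℝ)) * ∑ i, u i j) := by
    simp only [dot, tmean_sum, tmean_const_mul, mul_sub, Finset.sum_sub_distrib]
    congr 1
    rw [Finset.sum_comm, Finset.mul_sum]
    refine Finset.sum_congr rfl fun j _ => ?_
    rw [← Finset.mul_sum]; ring
  rw [e]
  exact abs_dot_le hgrad

/-- The deterministic oracle inequality: a gradient bound and restricted strong convexity at the
true parameter control the `ℓ₁` error of the minimizer. -/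
theorem l1_error_le (hm : 0 < m) {φ : E → Fin p → ℝ} {h : E → ℝ} (hpos : ∀ y, 0 < h y)
    {lam₁ lam₂ : ℝ} (hlam₁ : 0 < lam₁) (hlam₂ : 0 < lam₂) {x : Fin n → E} {y : Fin m → E}
    {θs θh : Fin p → ℝ} (hmin : IsMinOn (enetCriterion φ h lam₁ lam₂ x y) Set.univ θh)
    {K B C ζ τ : ℝ} {s : ℕ} (hC : 0 < C) (hζ : 1 < ζ) (hs : 0 < s)
    (hφK : ∀ y j, |φ y j| ≤ K) (hθB : ∀ j, |θs j| ≤ B)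
    (hτ : τ = (ζ - 1) / (ζ + 1) * lam₁ - 2 * lam₂ * B) (hK : 0 < K) (hB : 0 < B)
    (hsmall : (ζ + 1) * s * lam₁ / C ≤ 1 / (4 * K * Real.exp 1))
    (hgrad : ∀ j, |tmean (fun i => Real.exp (dot θs (φ (y i))) / h (y i))
      (fun i => φ (y i) j) - (1 / (n : ℝ)) * ∑ i, φ (x i) j| ≤ τ)
    (hcurv : ∀ b ∈ cone ζ (supp θs), 7 / 16 * C / s * l1On (supp θs) b ^ 2 ≤
      tvar (fun i => Real.exp (dot θs (φ (y i))) / h (y i)) (fun i => dot b (φ (y i)))) :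
    l1 (θh - θs) ≤ Real.exp 1 * ((ζ + 1) * s * lam₁ / C) := by
  have : Nonempty (Fin m) := ⟨⟨0, hm⟩⟩
  by_contra hcon
  push Not at hcon
  set R := (ζ + 1) * s * lam₁ / C with hR
  have hs' : (0 : ℝ) < s := by exact_mod_cast hs
  have hR0 : 0 < R := by
    have : 0 < ζ + 1 := by linarith
    positivity
  set Δ := θh - θs with hΔ
  set T := supp θs with hT
  set D := l1 Δ with hD
  set t₀ := Real.exp 1 * R with ht₀
  have ht₀0 : 0 < t₀ := by positivity
  have hD0 : 0 < D := ht₀0.trans hcon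
  set X := l1On T Δ with hX
  have hX0 : 0 ≤ X := l1On_nonneg _ _
  have hcompl : l1On Tᶜ Δ = D - X := by
    have := l1On_add_compl T Δ
    linarith
  set w : Fin m → ℝ := fun i => Real.exp (dot θs (φ (y i))) / h (y i) with hw
  have hw0 : ∀ i, 0 < w i := fun i => div_pos (Real.exp_pos _) (hpos _)
  set a : Fin m → ℝ := fun i => dot Δ (φ (y i)) with ha
  have hg := (abs_le.1 (abs_tmean_dot_sub_le (w := w) (v := fun i => φ (y i))
    (u := fun i => φ (x i)) hgrad Δ)).1
  have hpen := penalty_difference_le (θh := θh) hlam₁ hlam₂ hθB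
  rw [← hΔ, ← hT, ← hX, hcompl] at hpen
  -- The definition of `τ` turns gradient error plus penalties into this form, up to the nonpositive
  -- term `-2 λ₂ B (D - X)`. The case `c = 0` then gives the cone condition.
  have hup : ∀ c < 1, tmean (fun i => w i * Real.exp (c * a i)) a - tmean w a ≤
      2 * lam₁ * (X - D / (ζ + 1)) := by
    intro c hc
    have h1 := minimizer_variational (θs := θs) hm hpos hlam₁ hmin hc
    have h2 : τ * D + ((lam₁ + 2 * lam₂ * B) * X - lam₁ * (D - X)) ≤
        2 * lam₁ * (X - D / (ζ + 1)) := by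
      have h3 : (ζ - 1) / (ζ + 1) * lam₁ = lam₁ - 2 * lam₁ * (1 / (ζ + 1)) := by
        have : ζ + 1 ≠ 0 := by linarith
        field_simp; ring
      have h4 : X ≤ D := by have := l1On_nonneg Tᶜ Δ; linarith
      have h5 : 0 ≤ 2 * lam₂ * B * (D - X) :=
        mul_nonneg (by positivity) (by linarith)
      rw [hτ, h3, div_eq_mul_one_div D]
      nlinarith
    linarith
  have hXD : D / (ζ + 1) ≤ X := by
    have h1 := hup 0 one_pos
    simp only [zero_mul, Real.exp_zero, mul_one, sub_self] at h1
    have : 0 ≤ X - D / (ζ + 1) := nonneg_of_mul_nonneg_right h1 (by positivity)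
    linarith
  have hζ1 : 0 < ζ + 1 := by linarith
  have hXpos : 0 < X := (div_pos hD0 hζ1).trans_le hXD
  have hcone : Δ ∈ cone ζ T := by
    rw [div_le_iff₀ hζ1] at hXD
    change l1On Tᶜ Δ ≤ ζ * l1On T Δ
    rw [hcompl]; linarith
  have hcv := hcurv Δ hcone
  -- Stops on the segment at `ℓ₁`-distance `t₀` from `θs`, where the exponents `c * a i` are at most
  -- `1/4` in modulus by `hsmall`.
  set c := t₀ / D with hc
  have hc1 : c < 1 := (div_lt_one hD0).2 hcon
  have hc0 : 0 < c := by positivity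
  have hcD : c * D = t₀ := div_mul_cancel₀ _ hD0.ne'
  have habs : ∀ i, |c * a i| ≤ K * t₀ := by
    intro i
    rw [abs_mul, abs_of_pos hc0, ← hcD]
    have := mul_le_mul_of_nonneg_left (abs_dot_le (θ := Δ) (hφK (y i))) hc0.le
    linarith
  have hlow := tmean_tilt_sub_ge hw0 (a := fun i => c * a i)
    (fun i => (abs_le.1 (habs i)).1) (fun i => (abs_le.1 (habs i)).2)
  rw [tmean_const_mul, tmean_const_mul, tvar_const_mul, ← mul_sub] at hlow
  have h1 := hlow.trans (mul_le_mul_of_nonneg_left (hup c hc1) hc0.le)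
  have hexp : 1 / Real.exp (1 / 2) ≤ Real.exp (-(K * t₀) - K * t₀) := by
    rw [one_div, ← Real.exp_neg, Real.exp_le_exp]
    have h2 : K * t₀ ≤ 1 / 4 := by
      rw [ht₀]
      calc K * (Real.exp 1 * R) ≤ K * (Real.exp 1 * (1 / (4 * K * Real.exp 1))) := by gcongr
        _ = 1 / 4 := by field_simp
    linarith
  have hV0 : 0 ≤ 7 / 16 * C / s * X ^ 2 := by positivity
  have h3 : 1 / Real.exp (1 / 2) * (c ^ 2 * (7 / 16 * C / s * X ^ 2)) ≤
      c * (2 * lam₁ * (X - D / (ζ + 1))) := by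
    refine le_trans ?_ h1
    exact mul_le_mul hexp (mul_le_mul_of_nonneg_left hcv (sq_nonneg c)) (by positivity)
      (Real.exp_pos _).le
  -- AM–GM in the form of a completed square; it eliminates both unknowns `X` and `D`.
  have h4 : 4 * (X - D / (ζ + 1)) * D ≤ (ζ + 1) * X ^ 2 := by
    have h5 : 0 ≤ (ζ + 1) * (X - 2 * D / (ζ + 1)) ^ 2 := by positivity
    have h6 : (ζ + 1) * (X - 2 * D / (ζ + 1)) ^ 2 =
        (ζ + 1) * X ^ 2 - 4 * (X - D / (ζ + 1)) * D := by
      field_simp; ring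
    linarith
  have h7 : t₀ * (1 / Real.exp (1 / 2) * (7 / 16 * C / s)) ≤ lam₁ * (ζ + 1) / 2 := by
    have hX2 : 0 < X ^ 2 := by positivity
    refine le_of_mul_le_mul_right ?_ (mul_pos hc0 hX2)
    have h8 := mul_le_mul_of_nonneg_right h3 hD0.le
    have h9 := mul_le_mul_of_nonneg_left h4 (show 0 ≤ c * lam₁ / 2 by positivity)
    calc t₀ * (1 / Real.exp (1 / 2) * (7 / 16 * C / s)) * (c * X ^ 2)
        = 1 / Real.exp (1 / 2) * (c ^ 2 * (7 / 16 * C / s * X ^ 2)) * D := by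
          rw [← hcD]; ring
      _ ≤ _ := h8
      _ ≤ lam₁ * (ζ + 1) / 2 * (c * X ^ 2) := by linarith
  -- `h7` now amounts to `7/16 · e^{1/2} ≤ 1/2`, whereas `7/16 · 3/2 = 21/32`.
  have hhalf : 3 / 2 ≤ Real.exp (1 / 2) := by
    have := Real.add_one_le_exp (1 / 2 : ℝ)
    linarith
  have hsq : Real.exp 1 = Real.exp (1 / 2) * Real.exp (1 / 2) := by
    rw [← Real.exp_add]; norm_num
  have h10 : t₀ * (1 / Real.exp (1 / 2) * (7 / 16 * C / s)) =
      Real.exp (1 / 2) * (7 / 16 * ((ζ + 1) * lam₁)) := by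
    rw [ht₀, hR, hsq]
    field_simp
  rw [h10] at h7
  have h11 : 0 < (ζ + 1) * lam₁ := by positivity
  nlinarith

end Oracle

/-! ### Restricted strong convexity on the cone. -/

section Curvature

lemma tmean_const_mul_weights {ι : Type*} [Fintype ι] {c : ℝ} (hc : c ≠ 0) (w a : ι → ℝ) :
    tmean (fun i => c * w i) a = tmean w a := by
  simp only [tmean, mul_assoc, ← Finset.mul_sum]
  exact mul_div_mul_left _ _ hc

lemma tvar_const_mul_weights {ι : Type*} [Fintype ι] {c : ℝ} (hc : c ≠ 0) (w a : ι → ℝ) :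
    tvar (fun i => c * w i) a = tvar w a := by
  simp only [tvar, tmean_const_mul_weights hc]

lemma tmean_sub_const {ι : Type*} [Fintype ι] [Nonempty ι] {w : ι → ℝ} (hw : ∀ i, 0 < w i)
    (a : ι → ℝ) (c : ℝ) : tmean w (fun i => a i - c) = tmean w a - c := by
  have := (sum_pos_of_weights hw).ne'
  simp only [tmean, mul_sub, Finset.sum_sub_distrib, ← Finset.sum_mul]
  field_simp

lemma tvar_sub_const {ι : Type*} [Fintype ι] [Nonempty ι] {w : ι → ℝ} (hw : ∀ i, 0 < w i)
    (a : ι → ℝ) (c : ℝ) : tvar w (fun i => a i - c) = tvar w a := by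
  have h := (sum_pos_of_weights hw).ne'
  have h1 := tvar_mul_sum hw a
  have h2 := tvar_mul_sum hw (fun i => a i - c)
  rw [tmean_sub_const hw] at h2
  have h3 : tvar w (fun i => a i - c) * ∑ i, w i = tvar w a * ∑ i, w i := by
    rw [h1, h2]
    exact Finset.sum_congr rfl fun i _ => by ring
  exact mul_right_cancel₀ h h3

lemma abs_tmean_le {ι : Type*} [Fintype ι] {w a : ι → ℝ} {N b : ℝ} (hN : 0 < N)
    (hw : N / 2 ≤ ∑ i, w i) (hb : |∑ i, w i * a i| ≤ N * b) : |tmean w a| ≤ 2 * b := by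
  have hW : 0 < ∑ i, w i := by linarith
  have hb0 : 0 ≤ b := nonneg_of_mul_nonneg_right ((abs_nonneg _).trans hb) hN
  rw [tmean, abs_div, abs_of_pos hW, div_le_iff₀ hW]
  nlinarith

lemma neg_le_tmean {ι : Type*} [Fintype ι] {w a : ι → ℝ} {N b : ℝ} (hb0 : 0 ≤ b) (hN : 0 < N)
    (hw : N / 2 ≤ ∑ i, w i) (hb : -(N * b) ≤ ∑ i, w i * a i) : -(2 * b) ≤ tmean w a := by
  have hW : 0 < ∑ i, w i := by linarith
  rw [tmean, le_div_iff₀ hW]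
  nlinarith

variable {E : Type*} [Fintype E] {n m p : ℕ}

lemma normConst_pos [Nonempty E] (φ : E → Fin p → ℝ) (θ : Fin p → ℝ) : 0 < normConst φ θ :=
  Finset.sum_pos (fun _ _ => Real.exp_pos _) Finset.univ_nonempty

lemma pmf_pos [Nonempty E] (φ : E → Fin p → ℝ) (θ : Fin p → ℝ) (x : E) : 0 < pmf φ θ x :=
  div_pos (Real.exp_pos _) (normConst_pos φ θ)

lemma sum_pmf [Nonempty E] (φ : E → Fin p → ℝ) (θ : Fin p → ℝ) : ∑ x, pmf φ θ x = 1 := by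
  simp only [pmf, ← Finset.sum_div]
  exact div_self (normConst_pos φ θ).ne'

lemma abs_meanStat_le [Nonempty E] {φ : E → Fin p → ℝ} {K : ℝ} (hφK : ∀ y j, |φ y j| ≤ K)
    (θ : Fin p → ℝ) (j : Fin p) : |meanStat φ θ j| ≤ K := by
  calc |meanStat φ θ j| ≤ ∑ x, |pmf φ θ x * φ x j| := Finset.abs_sum_le_sum_abs _ _
    _ ≤ ∑ x, pmf φ θ x * K := by
        refine Finset.sum_le_sum fun x _ => ?_
        rw [abs_mul, abs_of_pos (pmf_pos φ θ x)]
        exact mul_le_mul_of_nonneg_left (hφK x j) (pmf_pos φ θ x).le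
    _ = K := by rw [← Finset.sum_mul, sum_pmf, one_mul]

lemma covStat_comm (φ : E → Fin p → ℝ) (θ : Fin p → ℝ) (j k : Fin p) :
    covStat φ θ j k = covStat φ θ k j :=
  Finset.sum_congr rfl fun x _ => by rw [mul_comm (φ x j - _)]

lemma covStat_diag_le [Nonempty E] {φ : E → Fin p → ℝ} {K : ℝ} (hφK : ∀ y j, |φ y j| ≤ K)
    (θ : Fin p → ℝ) (j : Fin p) : covStat φ θ j j ≤ K ^ 2 := by
  have h1 := sum_mul_sq_sub_mean (sum_pmf φ θ) (fun x => φ x j)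
  have h2 : covStat φ θ j j = ∑ x, pmf φ θ x * (φ x j - ∑ x, pmf φ θ x * φ x j) ^ 2 :=
    Finset.sum_congr rfl fun x _ => by rw [sq]; rfl
  have h3 : ∑ x, pmf φ θ x * φ x j ^ 2 ≤ ∑ x, pmf φ θ x * K ^ 2 := by
    refine Finset.sum_le_sum fun x _ => mul_le_mul_of_nonneg_left ?_ (pmf_pos φ θ x).le
    exact sq_le_sq' (abs_le.1 (hφK x j)).1 (abs_le.1 (hφK x j)).2
  rw [← Finset.sum_mul, sum_pmf, one_mul] at h3
  rw [h2, h1]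
  nlinarith [sq_nonneg (∑ x, pmf φ θ x * φ x j)]

/-- Bounding each product separately would give `8K²`. Polarization together with `|x - y| + |x + y|
≤ 2K` halves this, as the constants of `delta₂` require. -/
lemma abs_bilinear_diff_le {K μ₁ μ₂ x₁ x₂ y₁ y₂ : ℝ} (hμ₁ : |μ₁| ≤ K) (hμ₂ : |μ₂| ≤ K)
    (hx₁ : |x₁| ≤ K) (hx₂ : |x₂| ≤ K) (hy₁ : |y₁| ≤ K) (hy₂ : |y₂| ≤ K) :
    |(x₁ - μ₁) * (x₂ - μ₂) - (y₁ - μ₁) * (y₂ - μ₂)| ≤ 4 * K ^ 2 := by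
  have key : ∀ {x y : ℝ}, |x| ≤ K → |y| ≤ K → |x - y| + |x + y| ≤ 2 * K := by
    intro x y hx hy
    rw [abs_le] at hx hy
    rcases abs_cases (x - y) with h | h <;> rcases abs_cases (x + y) with h' | h' <;> linarith
  have h1 := key hx₁ hy₁
  have h2 := key hx₂ hy₂
  have hd1 := abs_nonneg (x₁ - y₁)
  have hd2 := abs_nonneg (x₂ - y₂)
  have ha1 := abs_nonneg (x₁ + y₁)
  have ha2 := abs_nonneg (x₂ + y₂)
  have h3 : |x₂ + y₂ - 2 * μ₂| ≤ |x₂ + y₂| + 2 * K := by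
    refine (abs_sub _ _).trans ?_
    rw [abs_mul, abs_two]; linarith
  have h4 : |x₁ + y₁ - 2 * μ₁| ≤ |x₁ + y₁| + 2 * K := by
    refine (abs_sub _ _).trans ?_
    rw [abs_mul, abs_two]; linarith
  have e : (x₁ - μ₁) * (x₂ - μ₂) - (y₁ - μ₁) * (y₂ - μ₂) =
      ((x₁ - y₁) * (x₂ + y₂ - 2 * μ₂) + (x₂ - y₂) * (x₁ + y₁ - 2 * μ₁)) / 2 := by ring
  have h5 : |(x₁ - y₁) * (x₂ + y₂ - 2 * μ₂) + (x₂ - y₂) * (x₁ + y₁ - 2 * μ₁)| ≤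
      |x₁ - y₁| * (4 * K - |x₂ - y₂|) + |x₂ - y₂| * (4 * K - |x₁ - y₁|) := by
    refine (abs_add_le _ _).trans ?_
    rw [abs_mul, abs_mul]
    exact add_le_add (mul_le_mul_of_nonneg_left (by linarith) hd1)
      (mul_le_mul_of_nonneg_left (by linarith) hd2)
  rw [e, abs_div, abs_two, div_le_iff₀ two_pos]
  nlinarith [mul_nonneg (show 0 ≤ 2 * K - |x₁ - y₁| by linarith)
    (show 0 ≤ 2 * K - |x₂ - y₂| by linarith)]

lemma abs_centered_product_sub_cov_le [Nonempty E] {φ : E → Fin p → ℝ} {K : ℝ}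
    (hφK : ∀ y j, |φ y j| ≤ K) (θ : Fin p → ℝ) (j k : Fin p) (x : E) :
    |(φ x j - meanStat φ θ j) * (φ x k - meanStat φ θ k) - covStat φ θ j k| ≤ 4 * K ^ 2 := by
  have e : (φ x j - meanStat φ θ j) * (φ x k - meanStat φ θ k) - covStat φ θ j k =
      ∑ y, pmf φ θ y * ((φ x j - meanStat φ θ j) * (φ x k - meanStat φ θ k) -
        (φ y j - meanStat φ θ j) * (φ y k - meanStat φ θ k)) := by
    simp only [mul_sub (pmf φ θ _) (_ * _), Finset.sum_sub_distrib, ← Finset.sum_mul, sum_pmf,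
      one_mul]
    rfl
  rw [e]
  refine (Finset.abs_sum_le_sum_abs _ _).trans ?_
  calc _ ≤ ∑ y, pmf φ θ y * (4 * K ^ 2) := by
        refine Finset.sum_le_sum fun y _ => ?_
        rw [abs_mul, abs_of_pos (pmf_pos φ θ y)]
        exact mul_le_mul_of_nonneg_left (abs_bilinear_diff_le (abs_meanStat_le hφK θ j)
          (abs_meanStat_le hφK θ k) (hφK x j) (hφK x k) (hφK y j) (hφK y k)) (pmf_pos φ θ y).le
    _ = _ := by rw [← Finset.sum_mul, sum_pmf, one_mul]

lemma l1_le_of_mem_cone {ζ : ℝ} {T : Finset (Fin p)} {b : Fin p → ℝ} (hb : b ∈ cone ζ T) :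
    l1 b ≤ (ζ + 1) * l1On T b := by
  have h1 := l1On_add_compl T b
  have h2 : l1On Tᶜ b ≤ ζ * l1On T b := hb
  linarith

lemma compat_mul_sq_le {C ζ : ℝ} {s : ℕ} (hs : 0 < s) {T : Finset (Fin p)}
    {H : Matrix (Fin p) (Fin p) ℝ} (hζ : 1 < ζ) (hcompat : (C : EReal) ≤ compatFactor s ζ T H)
    {b : Fin p → ℝ} (hb : b ∈ cone ζ T) :
    C / s * l1On T b ^ 2 ≤ dot b (H.mulVec b) := by
  by_cases hb0 : b = 0
  · subst hb0
    simp [dot, l1On]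
  have h1 : (C : EReal) ≤ (((s : ℝ) * dot b (H.mulVec b) / l1On T b ^ 2 : ℝ) : EReal) :=
    hcompat.trans (iInf_le (fun θ : {θ : Fin p → ℝ // θ ≠ 0 ∧ θ ∈ cone ζ T} =>
      (((s : ℝ) * dot θ.1 (H.mulVec θ.1) / l1On T θ.1 ^ 2 : ℝ) : EReal)) ⟨b, hb0, hb⟩)
  rw [EReal.coe_le_coe_iff] at h1
  have hl : 0 < l1 b := by
    obtain ⟨j, hj⟩ := Function.ne_iff.1 hb0
    exact Finset.sum_pos' (fun _ _ => abs_nonneg _) ⟨j, Finset.mem_univ j, abs_pos.2 hj⟩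
  have hx : 0 < l1On T b :=
    pos_of_mul_pos_right (hl.trans_le (l1_le_of_mem_cone hb)) (by linarith)
  rw [le_div_iff₀ (by positivity)] at h1
  have hs' : (0 : ℝ) < s := by exact_mod_cast hs
  rw [div_mul_eq_mul_div, div_le_iff₀ hs']
  linarith

/-- Tests the compatibility factor on a coordinate vector. With the variance bound `K²` this yields
`τ₂ ≤ K²/8`. -/
lemma compat_le_of_diag_le {C ζ K : ℝ} {s : ℕ} (hs : 0 < s) {T : Finset (Fin p)}
    {H : Matrix (Fin p) (Fin p) ℝ} (hζ : 1 < ζ) (hcompat : (C : EReal) ≤ compatFactor s ζ T H)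
    {j : Fin p} (hj : j ∈ T) (hH : H j j ≤ K) : C / s ≤ K := by
  have h0 : l1On Tᶜ (Pi.single j (1 : ℝ)) = 0 := by
    refine Finset.sum_eq_zero fun i hi => ?_
    have : i ≠ j := fun h => (Finset.mem_compl.1 hi) (h ▸ hj)
    simp [this]
  have h1 : l1On T (Pi.single j (1 : ℝ)) = 1 := by
    simp [l1On, Pi.single_apply, apply_ite abs, hj]
  have hmem : Pi.single j (1 : ℝ) ∈ cone ζ T := by
    change l1On Tᶜ _ ≤ ζ * l1On T _
    rw [h0, h1]; linarith
  have h2 := compat_mul_sq_le hs hζ hcompat hmem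
  rw [h1] at h2
  simp [dot, Pi.single_apply] at h2
  linarith

/-- Diagonal entries are multiplied by `b_j² ≥ 0`, so only their lower tail matters. -/
lemma neg_mul_l1_sq_le_sum {D : Fin p → Fin p → ℝ} {τ : ℝ} (hdiag : ∀ j, -τ ≤ D j j)
    (hoff : ∀ j k, j ≠ k → |D j k| ≤ τ) (b : Fin p → ℝ) :
    -(τ * l1 b ^ 2) ≤ ∑ j, ∑ k, b j * b k * D j k := by
  have e : -(τ * l1 b ^ 2) = ∑ j, ∑ k, -(τ * (|b j| * |b k|)) := by
    simp only [Finset.sum_neg_distrib, ← Finset.mul_sum, l1, sq, Finset.sum_mul_sum]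
  rw [e]
  refine Finset.sum_le_sum fun j _ => Finset.sum_le_sum fun k _ => ?_
  by_cases hjk : j = k
  · subst hjk
    rw [abs_mul_abs_self]
    nlinarith [mul_le_mul_of_nonneg_left (hdiag j) (mul_self_nonneg (b j))]
  · have h1 := mul_le_mul_of_nonneg_left (hoff j k hjk)
      (mul_nonneg (abs_nonneg (b j)) (abs_nonneg (b k)))
    rw [← abs_mul, ← abs_mul] at h1
    rw [← abs_mul]
    linarith [neg_abs_le (b j * b k * D j k)]

lemma dot_mulVec_eq (H : Matrix (Fin p) (Fin p) ℝ) (b : Fin p → ℝ) :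
    dot b (H.mulVec b) = ∑ j, ∑ k, b j * b k * H j k := by
  simp only [dot, Matrix.mulVec, dotProduct, Finset.mul_sum]
  exact Finset.sum_congr rfl fun j _ => Finset.sum_congr rfl fun k _ => by ring

lemma dot_sq (b v : Fin p → ℝ) : dot b v ^ 2 = ∑ j, ∑ k, b j * b k * (v j * v k) := by
  rw [sq, dot, Finset.sum_mul_sum]
  exact Finset.sum_congr rfl fun j _ => Finset.sum_congr rfl fun k _ => by ring

/-- The sign used to control both tails of the off-diagonal entries of a symmetric matrix, and
only the lower tail of the diagonal ones, by one event for each ordered pair. -/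
def pairSign (j k : Fin p) : ℝ := if j < k then 1 else -1

/-- Restricted strong convexity of the Monte Carlo likelihood. -/
lemma tvar_ge_of_deviation [Nonempty E] (hm : 0 < m) {φ : E → Fin p → ℝ} {θ : Fin p → ℝ}
    {y : Fin m → E} {w : Fin m → ℝ} (hw : ∀ i, 0 < w i) {K C ζ τ : ℝ} {s : ℕ} (hK : 0 < K)
    (hζ : 1 < ζ) (hs : 0 < s) {T : Finset (Fin p)}
    (hcompat : (C : EReal) ≤ compatFactor s ζ T (covStat φ θ))
    (hτ : τ = C / (2 * s * (ζ + 1) ^ 2)) (hτ0 : 0 ≤ τ) (hτK : τ ≤ K ^ 2 / 8)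
    (hmass : (m : ℝ) / 2 ≤ ∑ i, w i)
    (hlin : ∀ j, |∑ i, w i * (φ (y i) j - meanStat φ θ j)| ≤ m * (τ / (2 * K)))
    (hquad : ∀ j k, ∑ i, w i * (pairSign j k * ((φ (y i) j - meanStat φ θ j) *
      (φ (y i) k - meanStat φ θ k) - covStat φ θ j k)) ≤ m * (τ / 2))
    {b : Fin p → ℝ} (hb : b ∈ cone ζ T) :
    7 / 16 * C / s * l1On T b ^ 2 ≤ tvar w (fun i => dot b (φ (y i))) := by
  have : Nonempty (Fin m) := ⟨⟨0, hm⟩⟩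
  have hm' : (0 : ℝ) < m := by exact_mod_cast hm
  have hs' : (0 : ℝ) < s := by exact_mod_cast hs
  set ψ : Fin m → Fin p → ℝ := fun i j => φ (y i) j - meanStat φ θ j with hψ
  set H := covStat φ θ with hH
  set D : Fin p → Fin p → ℝ := fun j k => tmean w (fun i => ψ i j * ψ i k - H j k) with hD
  have hpull : ∀ j k, ∑ i, w i * (pairSign j k * (ψ i j * ψ i k - H j k)) =
      pairSign j k * ∑ i, w i * (ψ i j * ψ i k - H j k) := by
    intro j k
    rw [Finset.mul_sum]
    exact Finset.sum_congr rfl fun i _ => by ring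
  have hlow : ∀ j k, ¬ j < k → -(m * (τ / 2)) ≤ ∑ i, w i * (ψ i j * ψ i k - H j k) := by
    intro j k hjk
    have := hquad j k
    rw [hpull, pairSign, if_neg hjk] at this
    linarith
  have hupp : ∀ j k, j < k → ∑ i, w i * (ψ i j * ψ i k - H j k) ≤ m * (τ / 2) := by
    intro j k hjk
    have := hquad j k
    rw [hpull, pairSign, if_pos hjk] at this
    linarith
  have hsymm : ∀ j k, ∑ i, w i * (ψ i j * ψ i k - H j k) =
      ∑ i, w i * (ψ i k * ψ i j - H k j) := by
    intro j k
    rw [hH, covStat_comm]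
    exact Finset.sum_congr rfl fun i _ => by ring
  have hdiag : ∀ j, -τ ≤ D j j := by
    intro j
    have := neg_le_tmean (by linarith) hm' hmass (hlow j j (lt_irrefl j))
    rw [mul_div_cancel₀ _ two_ne_zero] at this
    exact this
  have hoff : ∀ j k, j ≠ k → |D j k| ≤ τ := by
    intro j k hjk
    have h1 : |∑ i, w i * (ψ i j * ψ i k - H j k)| ≤ m * (τ / 2) := by
      rcases lt_or_gt_of_ne hjk with h | h
      · rw [abs_le]
        refine ⟨?_, hupp j k h⟩
        rw [hsymm]; exact hlow k j h.not_gt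
      · rw [abs_le]
        refine ⟨hlow j k h.not_gt, ?_⟩
        rw [hsymm]; exact hupp k j h
    have := abs_tmean_le hm' hmass h1
    rw [mul_div_cancel₀ _ two_ne_zero] at this
    exact this
  have hshift : tvar w (fun i => dot b (φ (y i))) = tvar w (fun i => dot b (ψ i)) := by
    rw [← tvar_sub_const hw _ (dot b (meanStat φ θ))]
    congr 1
    funext i
    simp only [dot, hψ, ← Finset.sum_sub_distrib, mul_sub]
  have hsq : tmean w (fun i => dot b (ψ i) ^ 2) =
      dot b (H.mulVec b) + ∑ j, ∑ k, b j * b k * D j k := by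
    have e : ∀ j k, b j * b k * D j k = b j * b k * tmean w (fun i => ψ i j * ψ i k)
        - b j * b k * H j k := by
      intro j k
      simp only [hD]
      rw [tmean_sub_const hw, mul_sub]
    rw [dot_mulVec_eq]
    simp only [e, Finset.sum_sub_distrib, dot_sq, tmean_sum, tmean_const_mul]
    ring
  have hmean : |tmean w (fun i => dot b (ψ i))| ≤ τ / K * l1 b := by
    have h1 : ∀ j, |tmean w (fun i => ψ i j)| ≤ τ / K := by
      intro j
      have := abs_tmean_le hm' hmass (hlin j)
      refine this.trans_eq ?_
      field_simp
    have e : tmean w (fun i => dot b (ψ i)) = dot b (fun j => tmean w (fun i => ψ i j)) := by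
      simp only [dot, tmean_sum, tmean_const_mul]
    rw [e]
    exact abs_dot_le h1
  have hl0 : 0 ≤ l1 b := Finset.sum_nonneg fun _ _ => abs_nonneg _
  -- Here `τ ≤ K²/8` makes the squared mean shift an eighth of the covariance error.
  have hmean2 : tmean w (fun i => dot b (ψ i)) ^ 2 ≤ τ / 8 * l1 b ^ 2 := by
    have h1 := sq_le_sq' (abs_le.1 hmean).1 (abs_le.1 hmean).2
    refine h1.trans ?_
    rw [mul_pow]
    refine mul_le_mul_of_nonneg_right ?_ (sq_nonneg _)
    rw [div_pow, div_le_iff₀ (by positivity)]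
    nlinarith
  have hdev := neg_mul_l1_sq_le_sum hdiag hoff b
  have hcomp := compat_mul_sq_le hs hζ hcompat hb
  have hcone := l1_le_of_mem_cone hb
  have hl2 : τ * l1 b ^ 2 ≤ C / (2 * s) * l1On T b ^ 2 := by
    calc τ * l1 b ^ 2 ≤ τ * ((ζ + 1) * l1On T b) ^ 2 := by gcongr
      _ = C / (2 * s) * l1On T b ^ 2 := by
          have : ζ + 1 ≠ 0 := by linarith
          rw [hτ]; field_simp
  have e1 : C / (2 * s) * l1On T b ^ 2 = 1 / 2 * (C / s * l1On T b ^ 2) := by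
    field_simp
  have e2 : 7 / 16 * C / s * l1On T b ^ 2 = 7 / 16 * (C / s * l1On T b ^ 2) := by ring
  -- On the cone `τ ‖b‖₁²` costs at most half of the curvature, so `1 - (1 + 1/8)/2 = 7/16` of it
  -- remains.
  rw [hshift, tvar, hsq, e2]
  rw [e1] at hl2
  linarith

end Curvature

/-! ### Concentration of importance-weighted sums and of the i.i.d. sample. -/

section Concentration

variable {E : Type*} [Fintype E] {n m p : ℕ}

lemma nonempty_of_isStationaryLaw {Q : Matrix E E ℝ} {h : E → ℝ} (hh : IsStationaryLaw Q h) :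
    Nonempty E := by
  by_contra hE
  rw [not_nonempty_iff] at hE
  simpa using hh.sum_eq_one

lemma ratio_le_bigM₂ (φ : E → Fin p → ℝ) (θ : Fin p → ℝ) (h : E → ℝ) (y : E) :
    pmf φ θ y / h y ≤ bigM₂ φ θ h :=
  le_ciSup (f := fun y => pmf φ θ y / h y) (Set.finite_range _).bddAbove y

lemma sum_mul_ratio {h : E → ℝ} (hpos : ∀ y, 0 < h y) (φ : E → Fin p → ℝ) (θ : Fin p → ℝ)
    (r : E → ℝ) : ∑ y, h y * (pmf φ θ y / h y * r y) = ∑ y, pmf φ θ y * r y :=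
  Finset.sum_congr rfl fun y _ => by
    have := (hpos y).ne'
    field_simp

lemma one_le_bigM₂ {Q : Matrix E E ℝ} {h : E → ℝ} (hh : IsStationaryLaw Q h)
    (φ : E → Fin p → ℝ) (θ : Fin p → ℝ) : 1 ≤ bigM₂ φ θ h := by
  have := nonempty_of_isStationaryLaw hh
  have h1 := sum_mul_ratio hh.pos φ θ (fun _ => 1)
  simp only [mul_one, sum_pmf] at h1
  rw [← h1]
  calc _ ≤ ∑ y, h y * bigM₂ φ θ h := Finset.sum_le_sum fun y _ =>
        mul_le_mul_of_nonneg_left (ratio_le_bigM₂ φ θ h y) (hh.pos y).le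
    _ = _ := by rw [← Finset.sum_mul, hh.sum_eq_one, one_mul]

lemma bigM₁_nonneg {h : E → ℝ} (hpos : ∀ y, 0 < h y) (φ : E → Fin p → ℝ) (θ : Fin p → ℝ) :
    0 ≤ bigM₁ φ θ h :=
  Finset.sum_nonneg fun y _ => mul_nonneg (hpos y).le (sq_nonneg _)

variable {Ω : Type*} [MeasurableSpace Ω] {μ : Measure Ω} [IsProbabilityMeasure μ]
  [MeasurableSpace E] [MeasurableSingletonClass E]

/-- The weight `p/h` turns centring under the model into centring under `h`; its second moment is
`M₁` and its maximum `M₂`. -/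
lemma importance_bernstein (hm : 0 < m) {Q : Matrix E E ℝ} {h : E → ℝ}
    (hQ : IsTransition Q) (hh : IsStationaryLaw Q h) {Y : Fin m → Ω → E}
    (hY : IsMarkovChain μ Q h Y) (hκ1 : kappa h Q < 1) (φ : E → Fin p → ℝ) (θ : Fin p → ℝ)
    {r : E → ℝ} (hmean : ∑ x, pmf φ θ x * r x = 0) {R t : ℝ} (hR : 0 < R)
    (hr : ∀ x, |r x| ≤ R) (ht : 0 < t) :
    μ.real {ω | m * t ≤ ∑ i, pmf φ θ (Y i ω) / h (Y i ω) * r (Y i ω)} ≤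
      Real.exp (-(m * t ^ 2 / (2 * (beta₁ (kappa h Q) * (R ^ 2 * bigM₁ φ θ h) +
        beta₂ (kappa h Q) * (R * bigM₂ φ θ h) * t)))) := by
  have hE := nonempty_of_isStationaryLaw hh
  have hM2 := one_le_bigM₂ hh φ θ
  have hg : ∀ x, 0 < pmf φ θ x / h x := fun x => div_pos (pmf_pos φ θ x) (hh.pos x)
  refine chain_bernstein hm hQ hh hY hκ1 (f := fun x => pmf φ θ x / h x * r x) ?_ ?_ ?_
    (by positivity) ht
  · rw [sum_mul_ratio hh.pos, hmean]
  · rw [bigM₁, Finset.mul_sum]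
    refine Finset.sum_le_sum fun x _ => ?_
    have h1 : r x ^ 2 ≤ R ^ 2 := sq_le_sq' (abs_le.1 (hr x)).1 (abs_le.1 (hr x)).2
    have h2 := mul_le_mul_of_nonneg_left h1
      (mul_nonneg (hh.pos x).le (sq_nonneg (pmf φ θ x / h x)))
    rw [mul_pow]
    linarith
  · intro x
    rw [abs_mul, abs_of_pos (hg x), mul_comm]
    exact mul_le_mul (hr x) (ratio_le_bigM₂ φ θ h x) (hg x).le hR.le

omit [IsProbabilityMeasure μ] in
lemma measureReal_abs_ge_le {Z : Ω → ℝ} {t b : ℝ} (h1 : μ.real {ω | t ≤ Z ω} ≤ b)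
    (h2 : μ.real {ω | t ≤ -Z ω} ≤ b) : μ.real {ω | t ≤ |Z ω|} ≤ 2 * b := by
  have : {ω | t ≤ |Z ω|} = {ω | t ≤ Z ω} ∪ {ω | t ≤ -Z ω} := by
    ext ω
    simp only [Set.mem_ofPred_eq, Set.mem_union, le_abs]
  rw [this]
  refine (measureReal_union_le _ _).trans ?_
  linarith

lemma importance_bernstein_abs (hm : 0 < m) {Q : Matrix E E ℝ} {h : E → ℝ}
    (hQ : IsTransition Q) (hh : IsStationaryLaw Q h) {Y : Fin m → Ω → E}
    (hY : IsMarkovChain μ Q h Y) (hκ1 : kappa h Q < 1) (φ : E → Fin p → ℝ) (θ : Fin p → ℝ)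
    {r : E → ℝ} (hmean : ∑ x, pmf φ θ x * r x = 0) {R t : ℝ} (hR : 0 < R)
    (hr : ∀ x, |r x| ≤ R) (ht : 0 < t) :
    μ.real {ω | m * t ≤ |∑ i, pmf φ θ (Y i ω) / h (Y i ω) * r (Y i ω)|} ≤
      2 * Real.exp (-(m * t ^ 2 / (2 * (beta₁ (kappa h Q) * (R ^ 2 * bigM₁ φ θ h) +
        beta₂ (kappa h Q) * (R * bigM₂ φ θ h) * t)))) := by
  refine measureReal_abs_ge_le (importance_bernstein hm hQ hh hY hκ1 φ θ hmean hR hr ht) ?_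
  have := importance_bernstein hm hQ hh hY hκ1 φ θ (r := fun x => -r x)
    (by simp only [mul_neg, Finset.sum_neg_distrib, hmean, neg_zero]) hR
    (fun x => by rw [abs_neg]; exact hr x) ht
  simpa only [mul_neg, Finset.sum_neg_distrib] using this

/-- Off this event the total weight is at least `m/2`, so normalizing at most doubles deviations.
Since `M₂ ≥ 1`, `M₂` also bounds `|1 - p/h|`. -/
lemma importance_mass_deviation (hm : 0 < m) {Q : Matrix E E ℝ} {h : E → ℝ}
    (hQ : IsTransition Q) (hh : IsStationaryLaw Q h) {Y : Fin m → Ω → E}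
    (hY : IsMarkovChain μ Q h Y) (hκ1 : kappa h Q < 1) (φ : E → Fin p → ℝ) (θ : Fin p → ℝ) :
    μ.real {ω | m * (1 / 2 : ℝ) ≤ ∑ i, (1 - pmf φ θ (Y i ω) / h (Y i ω))} ≤
      Real.exp (-(m / (4 * (2 * beta₁ (kappa h Q) * bigM₁ φ θ h +
        beta₂ (kappa h Q) * bigM₂ φ θ h)))) := by
  have hE := nonempty_of_isStationaryLaw hh
  have hM2 := one_le_bigM₂ hh φ θ
  have hg : ∀ x, 0 < pmf φ θ x / h x := fun x => div_pos (pmf_pos φ θ x) (hh.pos x)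
  have hsum : ∑ x, h x * (pmf φ θ x / h x) = 1 := by
    have h1 := sum_mul_ratio hh.pos φ θ (fun _ => 1)
    simpa only [mul_one, sum_pmf] using h1
  refine (chain_bernstein hm hQ hh hY hκ1 (f := fun x => 1 - pmf φ θ x / h x)
    (v := bigM₁ φ θ h) (c := bigM₂ φ θ h) ?_ ?_ ?_ (by linarith) one_half_pos).trans_eq ?_
  · simp only [mul_sub, Finset.sum_sub_distrib, hsum, mul_one, hh.sum_eq_one, sub_self]
  · have e : ∀ x, h x * (1 - pmf φ θ x / h x) ^ 2 =
        h x - 2 * (h x * (pmf φ θ x / h x)) + h x * (pmf φ θ x / h x) ^ 2 := fun x => by ring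
    simp only [e, Finset.sum_add_distrib, Finset.sum_sub_distrib, ← Finset.mul_sum, hsum,
      hh.sum_eq_one]
    rw [bigM₁]; linarith
  · intro x
    have := ratio_le_bigM₂ φ θ h x
    have := hg x
    rw [abs_le]
    constructor <;> linarith
  · rw [show (m : ℝ) * (1 / 2) ^ 2 = m / 4 by ring, div_div]
    congr 3
    ring

lemma IsIIDSample.integral_comp {f : E → ℝ} {X : Fin n → Ω → E} (hX : IsIIDSample μ f X)
    (i : Fin n) (r : E → ℝ) : ∫ ω, r (X i ω) ∂μ = ∑ x, f x * r x := by
  have hm := hX.measurable i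
  have : IsProbabilityMeasure (μ.map (X i)) := Measure.isProbabilityMeasure_map hm.aemeasurable
  rw [← integral_map hm.aemeasurable (measurable_of_finite r).aestronglyMeasurable,
    integral_fintype (Integrable.of_finite)]
  refine Finset.sum_congr rfl fun x _ => ?_
  rw [map_measureReal_apply hm (measurableSet_singleton x), smul_eq_mul, ← hX.law i x]
  rfl

lemma IsIIDSample.hoeffding (hn : 0 < n) {f : E → ℝ} {X : Fin n → Ω → E}
    (hX : IsIIDSample μ f X) {r : E → ℝ} {K t : ℝ} (hK : 0 < K) (hr : ∀ x, |r x| ≤ K)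
    (ht : 0 ≤ t) :
    μ.real {ω | n * t ≤ ∑ i, (r (X i ω) - ∑ x, f x * r x)} ≤
      Real.exp (-(n * t ^ 2 / (2 * K ^ 2))) := by
  have hsub : ∀ i ∈ (Finset.univ : Finset (Fin n)), HasSubgaussianMGF
      (fun ω => r (X i ω) - ∑ x, f x * r x) ((‖K - -K‖₊ / 2) ^ 2) μ := by
    intro i _
    have h1 := hasSubgaussianMGF_of_mem_Icc (μ := μ) (X := fun ω => r (X i ω)) (a := -K) (b := K)
      ((measurable_of_finite r).comp (hX.measurable i)).aemeasurable
      (Filter.Eventually.of_forall fun ω => abs_le.1 (hr _))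
    rwa [hX.integral_comp i r] at h1
  have hind : iIndepFun (fun i ω => r (X i ω) - ∑ x, f x * r x) μ :=
    hX.indep.comp (fun _ x => r x - ∑ x, f x * r x) fun _ => measurable_of_finite _
  have h2 := HasSubgaussianMGF.measure_sum_ge_le_of_iIndepFun hind hsub
    (show 0 ≤ n * t by positivity)
  refine h2.trans_eq ?_
  congr 1
  have hn' : (n : ℝ) ≠ 0 := by positivity
  have e : (K - -K) / 2 = K := by ring
  have e2 : ((∑ _i : Fin n, (‖K - -K‖₊ / 2) ^ 2 : NNReal) : ℝ) = n * K ^ 2 := by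
    push_cast
    rw [Real.norm_eq_abs, abs_of_pos (by linarith : 0 < K - -K), e]
    simp
  rw [e2]
  field_simp

lemma IsIIDSample.hoeffding_abs (hn : 0 < n) {f : E → ℝ} {X : Fin n → Ω → E}
    (hX : IsIIDSample μ f X) {r : E → ℝ} {K t : ℝ} (hK : 0 < K) (hr : ∀ x, |r x| ≤ K)
    (ht : 0 ≤ t) :
    μ.real {ω | n * t ≤ |∑ i, (r (X i ω) - ∑ x, f x * r x)|} ≤
      2 * Real.exp (-(n * t ^ 2 / (2 * K ^ 2))) := by
  refine measureReal_abs_ge_le (hX.hoeffding hn hK hr ht) ?_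
  have := hX.hoeffding hn (r := fun x => -r x) hK (fun x => by rw [abs_neg]; exact hr x) ht
  refine Eq.trans_le ?_ this
  congr 2
  ext ω
  simp only [mul_neg, Finset.sum_neg_distrib, Finset.sum_sub_distrib]
  ring_nf

end Concentration

/-! ### Union bound and the probabilistic oracle inequality. -/

section Main

variable {E : Type*} [Fintype E] {n m p : ℕ}

/-- On the event that all deviations are small, the estimation error is small. -/
lemma l1_error_le_of_deviations (hn : 0 < n) (hm : 0 < m) [Nonempty E] {φ : E → Fin p → ℝ}
    {h : E → ℝ}
    (hpos : ∀ y, 0 < h y) {lam₁ lam₂ : ℝ} (hlam₁ : 0 < lam₁) (hlam₂ : 0 < lam₂)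
    {x : Fin n → E} {y : Fin m → E} {θs θh : Fin p → ℝ}
    (hmin : IsMinOn (enetCriterion φ h lam₁ lam₂ x y) Set.univ θh)
    {K B C ζ τ₁ τ₂ : ℝ} {s : ℕ} (hC : 0 < C) (hζ : 1 < ζ) (hs : 0 < s)
    (hφK : ∀ y j, |φ y j| ≤ K) (hθB : ∀ j, |θs j| ≤ B)
    (hcompat : (C : EReal) ≤ compatFactor s ζ (supp θs) (covStat φ θs))
    (hτ₁ : τ₁ = (ζ - 1) / (ζ + 1) * lam₁ - 2 * lam₂ * B)
    (hτ₂ : τ₂ = C / (2 * s * (ζ + 1) ^ 2)) (hτK : τ₂ ≤ K ^ 2 / 8) (hK : 0 < K) (hB : 0 < B)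
    (hsmall : (ζ + 1) * s * lam₁ / C ≤ 1 / (4 * K * Real.exp 1))
    (hmass : ∑ i, (1 - pmf φ θs (y i) / h (y i)) ≤ m * (1 / 2 : ℝ))
    (hX : ∀ j, |∑ i, (φ (x i) j - meanStat φ θs j)| ≤ n * (τ₁ / 2))
    (hY : ∀ j, |∑ i, pmf φ θs (y i) / h (y i) * (φ (y i) j - meanStat φ θs j)| ≤
      m * (τ₁ / 4))
    (hlin : ∀ j, |∑ i, pmf φ θs (y i) / h (y i) * (φ (y i) j - meanStat φ θs j)| ≤
      m * (τ₂ / (2 * K)))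
    (hquad : ∀ j k, ∑ i, pmf φ θs (y i) / h (y i) *
      (pairSign j k * ((φ (y i) j - meanStat φ θs j) *
        (φ (y i) k - meanStat φ θs k) - covStat φ θs j k)) ≤ m * (τ₂ / 2)) :
    l1 (θh - θs) ≤ Real.exp 1 * ((ζ + 1) * s * lam₁ / C) := by
  have : Nonempty (Fin m) := ⟨⟨0, hm⟩⟩
  have hm' : (0 : ℝ) < m := by exact_mod_cast hm
  have hn' : (0 : ℝ) < n := by exact_mod_cast hn
  have hs' : (0 : ℝ) < s := by exact_mod_cast hs
  have hτ₂0 : 0 ≤ τ₂ := by rw [hτ₂]; positivity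
  have hN := normConst_pos φ θs
  set g : Fin m → ℝ := fun i => pmf φ θs (y i) / h (y i) with hg
  have hg0 : ∀ i, 0 < g i := fun i => div_pos (pmf_pos φ θs _) (hpos _)
  -- The normalizing constant cancels in weighted means, so the likelihood weights may be replaced
  -- by `p/h`.
  have hgw : (fun i => Real.exp (dot θs (φ (y i))) / h (y i)) =
      fun i => normConst φ θs * g i := by
    funext i
    simp only [hg, pmf]
    field_simp
  have hmass' : (m : ℝ) / 2 ≤ ∑ i, g i := by
    rw [Finset.sum_sub_distrib] at hmass
    simp only [Finset.sum_const, Finset.card_univ, Fintype.card_fin, nsmul_eq_mul,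
      mul_one] at hmass
    linarith
  refine l1_error_le hm hpos hlam₁ hlam₂ hmin hC hζ hs hφK hθB hτ₁ hK hB hsmall ?_ ?_
  · intro j
    rw [hgw, tmean_const_mul_weights hN.ne']
    have h1 := abs_tmean_le hm' hmass' (hY j)
    rw [tmean_sub_const hg0] at h1
    have h2 : (1 / (n : ℝ)) * ∑ i, φ (x i) j - meanStat φ θs j =
        (∑ i, (φ (x i) j - meanStat φ θs j)) / n := by
      rw [Finset.sum_sub_distrib]
      simp only [Finset.sum_const, Finset.card_univ, Fintype.card_fin, nsmul_eq_mul]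
      field_simp
    have h3 : |(1 / (n : ℝ)) * ∑ i, φ (x i) j - meanStat φ θs j| ≤ τ₁ / 2 := by
      rw [h2, abs_div, abs_of_pos hn', div_le_iff₀ hn']
      linarith [hX j]
    rw [abs_le] at h1 h3 ⊢
    constructor <;> linarith [h1.1, h1.2, h3.1, h3.2]
  · intro b hb
    rw [hgw, tvar_const_mul_weights hN.ne']
    exact tvar_ge_of_deviation hm hg0 hK hζ hs hcompat hτ₂ hτ₂0 hτK hmass' hlin hquad hb

lemma measureReal_iUnion_le_mul {Ω : Type*} [MeasurableSpace Ω] {μ : Measure Ω}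
    [IsProbabilityMeasure μ] {A : Fin p → Set Ω} {b : ℝ} (hA : ∀ j, μ.real (A j) ≤ b) :
    μ.real (⋃ j, A j) ≤ p * b := by
  refine (measureReal_iUnion_fintype_le A).trans ?_
  calc ∑ j, μ.real (A j) ≤ ∑ _j : Fin p, b := Finset.sum_le_sum fun j _ => hA j
    _ = p * b := by simp

/-- Absorption of the union bound for the linear statistics into the slack of that for the
quadratic ones. -/
lemma linear_term_le {p m : ℕ} (hp : 0 < p) {K A D τ : ℝ} (hK : 0 < K) (hA : 0 ≤ A)
    (hD : 0 < D) (hτ : 0 < τ)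
    (hle : 2 * (p : ℝ) ^ 2 * Real.exp
      (-(m * τ ^ 2 / (16 * K ^ 2 * (8 * K ^ 2 * A + τ * D)))) ≤ 1) :
    p * (2 * Real.exp (-(m * (τ / (2 * K)) ^ 2 /
      (2 * ((2 * K) ^ 2 * A + 2 * K * D * (τ / (2 * K))))))) ≤
      (p : ℝ) ^ 2 * Real.exp (-(m * τ ^ 2 / (16 * K ^ 2 * (8 * K ^ 2 * A + τ * D)))) := by
  have hp' : (1 : ℝ) ≤ p := by exact_mod_cast hp
  set G := m * τ ^ 2 / (16 * K ^ 2 * (8 * K ^ 2 * A + τ * D)) with hG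
  have h1 : 2 * G ≤ m * (τ / (2 * K)) ^ 2 /
      (2 * ((2 * K) ^ 2 * A + 2 * K * D * (τ / (2 * K)))) := by
    have e1 : 2 * G = m * τ ^ 2 / (64 * K ^ 4 * A + 8 * K ^ 2 * (τ * D)) := by
      rw [hG, show 16 * K ^ 2 * (8 * K ^ 2 * A + τ * D) =
        2 * (64 * K ^ 4 * A + 8 * K ^ 2 * (τ * D)) by ring]
      have : 64 * K ^ 4 * A + 8 * K ^ 2 * (τ * D) ≠ 0 := by positivity
      field_simp
    have e2 : m * (τ / (2 * K)) ^ 2 / (2 * ((2 * K) ^ 2 * A + 2 * K * D * (τ / (2 * K)))) =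
        m * τ ^ 2 / (32 * K ^ 4 * A + 8 * K ^ 2 * (τ * D)) := by
      have e3 : 2 * K * D * (τ / (2 * K)) = τ * D := by field_simp
      rw [e3, div_pow, ← mul_div_assoc, div_div]
      congr 1
      ring
    rw [e1, e2]
    apply div_le_div_of_nonneg_left (by positivity) (by positivity)
    have : 0 ≤ K ^ 4 * A := by positivity
    linarith
  have h2 : Real.exp (-(m * (τ / (2 * K)) ^ 2 /
      (2 * ((2 * K) ^ 2 * A + 2 * K * D * (τ / (2 * K)))))) ≤ Real.exp (-G) * Real.exp (-G) := by
    rw [← Real.exp_add, Real.exp_le_exp]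
    linarith
  set x := Real.exp (-G) with hx
  have hx0 : 0 < x := Real.exp_pos _
  calc _ ≤ p * (2 * (x * x)) := by gcongr
    _ ≤ p * p * (2 * (x * x)) := by
        gcongr
        exact le_mul_of_one_le_left (by positivity) hp'
    _ = (2 * p ^ 2 * x) * x := by ring
    _ ≤ 1 * x := by gcongr
    _ ≤ p ^ 2 * x := by
        gcongr
        nlinarith

lemma sum_pmf_mul_centered {E : Type*} [Fintype E] [Nonempty E] {p : ℕ} (φ : E → Fin p → ℝ)
    (θ : Fin p → ℝ) (j : Fin p) : ∑ x, pmf φ θ x * (φ x j - meanStat φ θ j) = 0 :=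
  sum_mul_sub_mean (sum_pmf φ θ) fun x => φ x j

lemma sum_pmf_mul_centered_product {E : Type*} [Fintype E] [Nonempty E] {p : ℕ}
    (φ : E → Fin p → ℝ) (θ : Fin p → ℝ) (j k : Fin p) (c : ℝ) :
    ∑ x, pmf φ θ x * (c * ((φ x j - meanStat φ θ j) * (φ x k - meanStat φ θ k) -
      covStat φ θ j k)) = 0 := by
  have := sum_mul_sub_mean (sum_pmf φ θ)
    fun x => (φ x j - meanStat φ θ j) * (φ x k - meanStat φ θ k)
  simp only [mul_left_comm _ c, ← Finset.mul_sum]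
  exact mul_eq_zero_of_right _ this

lemma exp_terms_nonneg {n m p : ℕ} (K β₁ β₂ M₁ M₂ τ₁ τ₂ : ℝ) :
    0 ≤ delta₁ n m p K β₁ β₂ M₁ M₂ τ₁ ∧ 0 ≤ delta₂ m p K β₁ β₂ M₁ M₂ τ₂ := by
  constructor
  · unfold delta₁; positivity
  · unfold delta₂; positivity

variable {E : Type*} [Fintype E] {n m p : ℕ}
  {Ω : Type*} [MeasurableSpace Ω] {μ : Measure Ω} [IsProbabilityMeasure μ]
  [MeasurableSpace E] [MeasurableSingletonClass E]

/-- The oracle inequality in probability, in the nondegenerate case. -/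
lemma oracle_probability_bound (hn : 0 < n) (hm : 0 < m) {φ : E → Fin p → ℝ}
    {θs : Fin p → ℝ} {X : Fin n → Ω → E} (hX : IsIIDSample μ (pmf φ θs) X)
    {Q : Matrix E E ℝ} {h : E → ℝ} (hQ : IsTransition Q) (hh : IsStationaryLaw Q h)
    {Y : Fin m → Ω → E} (hY : IsMarkovChain μ Q h Y) (hκ1 : kappa h Q < 1)
    {lam₁ lam₂ : ℝ} (hlam₁ : 0 < lam₁) (hlam₂ : 0 < lam₂) {θh : Ω → Fin p → ℝ}
    (hmin : ∀ ω, IsMinOn (enetCriterion φ h lam₁ lam₂ (fun i => X i ω) (fun i => Y i ω))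
      Set.univ (θh ω))
    {K B C ζ τ₁ τ₂ : ℝ} {s : ℕ} (hC : 0 < C) (hζ : 1 < ζ) (hs : s = (supp θs).card)
    (hs0 : 0 < s) (hφK : ∀ y j, |φ y j| ≤ K) (hθB : ∀ j, |θs j| ≤ B)
    (hcompat : (C : EReal) ≤ compatFactor s ζ (supp θs) (covStat φ θs))
    (hτ₁ : τ₁ = (ζ - 1) / (ζ + 1) * lam₁ - 2 * lam₂ * B)
    (hτ₂ : τ₂ = C / (2 * s * (ζ + 1) ^ 2)) (hτ₁0 : 0 < τ₁) (hK : 0 < K) (hB : 0 < B)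
    (hsmall : (ζ + 1) * s * lam₁ / C ≤ 1 / (4 * K * Real.exp 1)) :
    1 - delta₁ n m p K (beta₁ (kappa h Q)) (beta₂ (kappa h Q)) (bigM₁ φ θs h) (bigM₂ φ θs h) τ₁
      - delta₂ m p K (beta₁ (kappa h Q)) (beta₂ (kappa h Q)) (bigM₁ φ θs h) (bigM₂ φ θs h) τ₂ ≤
      μ.real {ω | l1 (θh ω - θs) ≤ Real.exp 1 * ((ζ + 1) * s * lam₁ / C)} := by
  have hE := nonempty_of_isStationaryLaw hh
  have hs' : (0 : ℝ) < s := by exact_mod_cast hs0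
  obtain ⟨j₀, hj₀⟩ := Finset.card_pos.1 (hs ▸ hs0)
  have hp : 0 < p := Fin.pos j₀
  have hτ₂0 : 0 < τ₂ := by
    have : 0 < ζ + 1 := by linarith
    rw [hτ₂]; positivity
  have hτK : τ₂ ≤ K ^ 2 / 8 := by
    have h1 := compat_le_of_diag_le hs0 hζ hcompat hj₀ (covStat_diag_le hφK θs j₀)
    have e : τ₂ = C / s / (2 * (ζ + 1) ^ 2) := by rw [hτ₂]; field_simp
    rw [e, div_le_div_iff₀ (by positivity) (by norm_num)]
    nlinarith [sq_nonneg K, mul_nonneg (sq_nonneg K) (show 0 ≤ (ζ + 1) ^ 2 - 4 by nlinarith)]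
  have hM1 := bigM₁_nonneg hh.pos φ θs
  have hM2 := one_le_bigM₂ hh φ θs
  have hb1 := beta₁_pos (kappa_nonneg h Q) hκ1
  have hb2 := beta₂_pos hκ1
  have hψ : ∀ x j, |φ x j - meanStat φ θs j| ≤ 2 * K := fun x j => by
    have := abs_sub (φ x j) (meanStat φ θs j)
    linarith [hφK x j, abs_meanStat_le hφK θs j]
  have hsign : ∀ (x : E) (j k : Fin p),
      |pairSign j k * ((φ x j - meanStat φ θs j) * (φ x k - meanStat φ θs k) -
        covStat φ θs j k)| ≤ 4 * K ^ 2 := by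
    intro x j k
    have : |pairSign j k| = 1 := by unfold pairSign; split_ifs <;> simp
    rw [abs_mul, this, one_mul]
    exact abs_centered_product_sub_cov_le hφK θs j k x
  set β₁ := beta₁ (kappa h Q) with hβ₁
  set β₂ := beta₂ (kappa h Q) with hβ₂
  set M₁ := bigM₁ φ θs h with hM₁
  set M₂ := bigM₂ φ θs h with hM₂
  set G := {ω | l1 (θh ω - θs) ≤ Real.exp 1 * ((ζ + 1) * s * lam₁ / C)} with hG
  set A₀ := {ω | m * (1 / 2 : ℝ) ≤ ∑ i, (1 - pmf φ θs (Y i ω) / h (Y i ω))} with hA₀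
  set A₁ := fun j => {ω | n * (τ₁ / 2) ≤ |∑ i, (φ (X i ω) j - meanStat φ θs j)|} with hA₁
  set A₂ := fun (t : ℝ) j => {ω | m * t ≤
    |∑ i, pmf φ θs (Y i ω) / h (Y i ω) * (φ (Y i ω) j - meanStat φ θs j)|} with hA₂
  set A₃ := fun j k => {ω | m * (τ₂ / 2) ≤ ∑ i, pmf φ θs (Y i ω) / h (Y i ω) *
    (pairSign j k * ((φ (Y i ω) j - meanStat φ θs j) * (φ (Y i ω) k - meanStat φ θs k) -
      covStat φ θs j k))} with hA₃
  -- A covering is used instead of complements: `θh` need not be measurable, and subadditivity holds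
  -- for arbitrary sets.
  have hcover : (Set.univ : Set Ω) ⊆ G ∪ (A₀ ∪ ((⋃ j, A₁ j) ∪ ((⋃ j, A₂ (τ₁ / 4) j) ∪
      ((⋃ j, A₂ (τ₂ / (2 * K)) j) ∪ ⋃ j, ⋃ k, A₃ j k)))) := by
    intro ω _
    by_contra hcon
    simp only [Set.mem_union, Set.mem_iUnion, not_or, not_exists] at hcon
    obtain ⟨h0, h1, h2, h3, h4, h5⟩ := hcon
    exact h0 (l1_error_le_of_deviations hn hm hh.pos hlam₁ hlam₂ (hmin ω) hC hζ hs0 hφK hθB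
      hcompat hτ₁ hτ₂ hτK hK hB hsmall (not_le.1 h1).le (fun j => (not_le.1 (h2 j)).le)
      (fun j => (not_le.1 (h3 j)).le) (fun j => (not_le.1 (h4 j)).le)
      (fun j k => (not_le.1 (h5 j k)).le))
  have b0 : μ.real A₀ ≤ Real.exp (-(m / (4 * (2 * β₁ * M₁ + β₂ * M₂)))) :=
    importance_mass_deviation hm hQ hh hY hκ1 φ θs
  have b1 : μ.real (⋃ j, A₁ j) ≤ p * (2 * Real.exp (-(n * τ₁ ^ 2 / (8 * K ^ 2)))) := by
    refine measureReal_iUnion_le_mul fun j => ?_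
    refine (hX.hoeffding_abs hn (r := fun x => φ x j) hK (fun x => hφK x j)
      (by positivity : 0 ≤ τ₁ / 2)).trans_eq ?_
    congr 3
    field_simp
    ring
  have bL : ∀ t, 0 < t → μ.real (⋃ j, A₂ t j) ≤ p * (2 * Real.exp (-(m * t ^ 2 /
      (2 * ((2 * K) ^ 2 * (β₁ * M₁) + 2 * K * (β₂ * M₂) * t))))) := by
    intro t ht
    refine measureReal_iUnion_le_mul fun j => ?_
    refine (importance_bernstein_abs hm hQ hh hY hκ1 φ θs (sum_pmf_mul_centered φ θs j)
      (by positivity : 0 < 2 * K) (fun x => hψ x j) ht).trans_eq ?_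
    congr 5
    ring
  have b2 : μ.real (⋃ j, A₂ (τ₁ / 4) j) ≤ p * (2 * Real.exp (-(m * τ₁ ^ 2 /
      (16 * K * (8 * K * β₁ * M₁ + τ₁ * β₂ * M₂))))) := by
    refine (bL _ (by positivity)).trans_eq ?_
    rw [div_pow, ← mul_div_assoc, div_div]
    congr 5
    ring
  have b4 : μ.real (⋃ j, ⋃ k, A₃ j k) ≤ p * (p * Real.exp (-(m * τ₂ ^ 2 /
      (16 * K ^ 2 * (8 * K ^ 2 * (β₁ * M₁) + τ₂ * (β₂ * M₂)))))) := by
    refine measureReal_iUnion_le_mul fun j => measureReal_iUnion_le_mul fun k => ?_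
    refine (importance_bernstein hm hQ hh hY hκ1 φ θs
      (sum_pmf_mul_centered_product φ θs j k (pairSign j k))
      (by positivity : 0 < 4 * K ^ 2) (fun x => hsign x j k)
      (by positivity : 0 < τ₂ / 2)).trans_eq ?_
    rw [div_pow, ← mul_div_assoc, div_div]
    congr 3
    ring
  have hprob : 1 ≤ μ.real G + (μ.real A₀ + (μ.real (⋃ j, A₁ j) +
      (μ.real (⋃ j, A₂ (τ₁ / 4) j) + (μ.real (⋃ j, A₂ (τ₂ / (2 * K)) j) +
        μ.real (⋃ j, ⋃ k, A₃ j k))))) := by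
    have h1 := measureReal_mono (μ := μ) hcover
    rw [probReal_univ] at h1
    refine h1.trans ((measureReal_union_le _ _).trans (add_le_add_right ?_ _))
    refine (measureReal_union_le _ _).trans (add_le_add_right ?_ _)
    refine (measureReal_union_le _ _).trans (add_le_add_right ?_ _)
    refine (measureReal_union_le _ _).trans (add_le_add_right ?_ _)
    exact measureReal_union_le _ _
  have hμG : 0 ≤ μ.real G := measureReal_nonneg
  have hassoc : 16 * K ^ 2 * (8 * K ^ 2 * β₁ * M₁ + τ₂ * β₂ * M₂) =
      16 * K ^ 2 * (8 * K ^ 2 * (β₁ * M₁) + τ₂ * (β₂ * M₂)) := by ring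
  unfold delta₁ delta₂
  rw [hassoc]
  have e1 : 0 ≤ 2 * (p : ℝ) * Real.exp (-(n * τ₁ ^ 2 / (8 * K ^ 2))) := by positivity
  have e2 : 0 ≤ 2 * (p : ℝ) * Real.exp
      (-(m * τ₁ ^ 2 / (16 * K * (8 * K * β₁ * M₁ + τ₁ * β₂ * M₂)))) := by positivity
  have e3 : 0 ≤ Real.exp (-(m / (4 * (2 * β₁ * M₁ + β₂ * M₂)))) := by positivity
  have e4 : 0 ≤ 2 * (p : ℝ) * Real.exp
      (-(m * τ₂ ^ 2 / (64 * K ^ 3 * (8 * K * β₁ * M₁ + τ₂ * β₂ * M₂)))) := by positivity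
  -- The signed pairs use only half of the `2p²` term; `linear_term_le` fits the linear events into
  -- the other half. If that term exceeds `1`, the claimed lower bound is negative.
  rcases le_or_gt (2 * (p : ℝ) ^ 2 * Real.exp (-(m * τ₂ ^ 2 /
    (16 * K ^ 2 * (8 * K ^ 2 * (β₁ * M₁) + τ₂ * (β₂ * M₂)))))) 1 with hle | hgt
  · have b3 := (bL _ (by positivity : 0 < τ₂ / (2 * K))).trans
      (linear_term_le hp hK (by positivity) (by positivity) hτ₂0 hle)
    linarith
  · linarith

end Main

end MCMCMLE

/-! ### The theorem, with the degenerate sizes treated separately. -/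

theorem mainTheorem3
    {V : Type*} [Fintype V] [DecidableEq V] {S : V → Type*} [∀ v, Fintype (S v)]
    [∀ v, MeasurableSpace (S v)] [∀ v, MeasurableSingletonClass (S v)]
    {Ω : Type*} [MeasurableSpace Ω] (μ : Measure Ω) [IsProbabilityMeasure μ]
    {n m p : ℕ} (φ : (∀ v, S v) → Fin p → ℝ) (θstar : Fin p → ℝ)
    (X : Fin n → Ω → ∀ v, S v)
    (hX : MCMCMLE.IsIIDSample μ (MCMCMLE.pmf φ θstar) X)
    (Q : Matrix (∀ v, S v) (∀ v, S v) ℝ) (h : (∀ v, S v) → ℝ)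
    (hQ : MCMCMLE.IsTransition Q) (hh : MCMCMLE.IsStationaryLaw Q h)
    (Y : Fin m → Ω → ∀ v, S v)
    (hY : MCMCMLE.IsMarkovChain μ Q h Y)
    (κ : ℝ) (hκ : κ = MCMCMLE.kappa h Q) (hgap : κ < 1)
    (β₁ β₂ M₁ M₂ : ℝ)
    (hβ₁ : β₁ = MCMCMLE.beta₁ κ) (hβ₂ : β₂ = MCMCMLE.beta₂ κ)
    (hM₁ : M₁ = MCMCMLE.bigM₁ φ θstar h) (hM₂ : M₂ = MCMCMLE.bigM₂ φ θstar h)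
    (lam₁ lam₂ : ℝ) (hlam₁ : 0 < lam₁) (hlam₂ : 0 < lam₂)
    (θhat : Ω → Fin p → ℝ)
    (hθhat : ∀ ω, IsMinOn
      (MCMCMLE.enetCriterion φ h lam₁ lam₂ (fun i => X i ω) (fun i => Y i ω))
      Set.univ (θhat ω))
    (K B Cmin ζ : ℝ) (hK : 0 < K) (hB : 0 < B) (hCmin : 0 < Cmin) (hζ : 1 < ζ)
    (hφK : ∀ y j, |φ y j| ≤ K)
    (hθB : ∀ j, |θstar j| ≤ B)
    (s : ℕ) (hs : s = (MCMCMLE.supp θstar).card)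
    (hcompat : (Cmin : EReal) ≤
      MCMCMLE.compatFactor s ζ (MCMCMLE.supp θstar) (MCMCMLE.covStat φ θstar))
    (τ₁ τ₂ : ℝ) (hτ₁ : τ₁ = (ζ - 1) / (ζ + 1) * lam₁ - 2 * lam₂ * B)
    (hτ₂ : τ₂ = Cmin / (2 * s * (ζ + 1) ^ 2))
    (hτ₁pos : 0 < τ₁)
    (hsmall : (ζ + 1) * s * lam₁ / Cmin ≤ 1 / (4 * K * Real.exp 1)) :
    1 - MCMCMLE.delta₁ n m p K β₁ β₂ M₁ M₂ τ₁ - MCMCMLE.delta₂ m p K β₁ β₂ M₁ M₂ τ₂ ≤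
      μ.real {ω | MCMCMLE.l1 (θhat ω - θstar) ≤
        Real.exp 1 * Cmin⁻¹ * (ζ + 1) * s * lam₁} := by
  subst hκ hβ₁ hβ₂ hM₁ hM₂
  have hset : {ω | MCMCMLE.l1 (θhat ω - θstar) ≤ Real.exp 1 * Cmin⁻¹ * (ζ + 1) * s * lam₁} =
      {ω | MCMCMLE.l1 (θhat ω - θstar) ≤ Real.exp 1 * ((ζ + 1) * s * lam₁ / Cmin)} := by
    have e : Real.exp 1 * Cmin⁻¹ * (ζ + 1) * s * lam₁ =
        Real.exp 1 * ((ζ + 1) * s * lam₁ / Cmin) := by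
      rw [div_eq_mul_inv]; ring
    rw [e]
  rw [hset]
  have hδ := MCMCMLE.exp_terms_nonneg (n := n) (m := m) (p := p) K
    (MCMCMLE.beta₁ (MCMCMLE.kappa h Q)) (MCMCMLE.beta₂ (MCMCMLE.kappa h Q))
    (MCMCMLE.bigM₁ φ θstar h) (MCMCMLE.bigM₂ φ θstar h) τ₁ τ₂
  rcases Nat.eq_zero_or_pos p with rfl | hp
  · have huniv : {ω | MCMCMLE.l1 (θhat ω - θstar) ≤
        Real.exp 1 * ((ζ + 1) * s * lam₁ / Cmin)} = Set.univ := by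
      refine Set.eq_univ_of_forall fun ω => ?_
      have hR : 0 ≤ Real.exp 1 * ((ζ + 1) * s * lam₁ / Cmin) := by positivity
      simpa [MCMCMLE.l1] using hR
    rw [huniv, probReal_univ]
    linarith [hδ.1, hδ.2]
  have hp' : (1 : ℝ) ≤ p := by exact_mod_cast hp
  -- For `m = 0` or `n = 0` an exponent of `delta₁` vanishes, so the claimed bound is at most `0`.
  rcases Nat.eq_zero_or_pos m with rfl | hm
  · refine le_trans ?_ measureReal_nonneg
    have h1 : 1 ≤ MCMCMLE.delta₁ n 0 p K (MCMCMLE.beta₁ (MCMCMLE.kappa h Q))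
        (MCMCMLE.beta₂ (MCMCMLE.kappa h Q)) (MCMCMLE.bigM₁ φ θstar h)
        (MCMCMLE.bigM₂ φ θstar h) τ₁ := by
      simp only [MCMCMLE.delta₁, Nat.cast_zero, zero_mul, zero_div, neg_zero, Real.exp_zero]
      exact le_add_of_nonneg_left (by positivity)
    linarith [hδ.2]
  rcases Nat.eq_zero_or_pos n with rfl | hn
  · refine le_trans ?_ measureReal_nonneg
    have h1 : 1 ≤ MCMCMLE.delta₁ 0 m p K (MCMCMLE.beta₁ (MCMCMLE.kappa h Q))
        (MCMCMLE.beta₂ (MCMCMLE.kappa h Q)) (MCMCMLE.bigM₁ φ θstar h)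
        (MCMCMLE.bigM₂ φ θstar h) τ₁ := by
      simp only [MCMCMLE.delta₁, Nat.cast_zero, zero_mul, zero_div, neg_zero, Real.exp_zero]
      rw [add_assoc]
      exact le_add_of_le_of_nonneg (by linarith) (by positivity)
    linarith [hδ.2]
  -- For `s = 0` division by zero gives `τ₂ = 0`, and `delta₂` exceeds `1`.
  rcases Nat.eq_zero_or_pos s with hs0 | hs0
  · refine le_trans ?_ measureReal_nonneg
    have hτ0 : τ₂ = 0 := by rw [hτ₂, hs0]; simp
    have h1 : 1 ≤ MCMCMLE.delta₂ m p K (MCMCMLE.beta₁ (MCMCMLE.kappa h Q))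
        (MCMCMLE.beta₂ (MCMCMLE.kappa h Q)) (MCMCMLE.bigM₁ φ θstar h)
        (MCMCMLE.bigM₂ φ θstar h) τ₂ := by
      simp only [MCMCMLE.delta₂, hτ0, ne_eq, OfNat.ofNat_ne_zero, not_false_eq_true, zero_pow,
        mul_zero, zero_div, neg_zero, Real.exp_zero, mul_one]
      have : 0 ≤ 2 * Real.exp (-((m : ℝ) / (4 * (2 * MCMCMLE.beta₁ (MCMCMLE.kappa h Q) *
        MCMCMLE.bigM₁ φ θstar h + MCMCMLE.beta₂ (MCMCMLE.kappa h Q) *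
          MCMCMLE.bigM₂ φ θstar h)))) := by positivity
      nlinarith
    linarith [hδ.1]
  exact MCMCMLE.oracle_probability_bound hn hm hX hQ hh hY hgap hlam₁ hlam₂ hθhat hCmin hζ hs
    hs0 hφK hθB hcompat hτ₁ hτ₂ hτ₁pos hK hB hsmall
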